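/- All sets are finite and non-empty and all logarithms are to base $2$; $S(p)=-p\log p-(1-p)\log(1-p)$ is the binary entropy. Let $f\subseteq X\times Y\times Z$ be a relation and $\mu$ a probability distribution on $X\times Y$. A total function $f:X\times Y\to Z$ is the relation $\{(x,y,z): f(x,y)=z\}$, and a partial function $f:X\times Y\to Z\cup\{*\}$ is the relation $\{(x,y,z): f(x,y)=z \text{ or } f(x,y)=*\}$. A one-way rectangle is a set $R=A\times Y$ with $A\subseteq X$. A distribution $\lambda$ on $X\times Y$ is one-way $\epsilon$-monochromatic for $f$ if there is $g:Y\to Z$ with $\Pr_{(x,y)\sim\lambda}[(x,y,g(y))\in f]\ge 1-\epsilon$. The one-way rectangle bound $\mathsf{rec}^{1,\mu}_\epsilon(f)$ is the minimum of $\log\frac1{\mu(R)}$ over the one-way rectangles $R$ with $\mu(R)>0$ for which $\mu$ conditioned on $R$ is one-way $\epsilon$-monochromatic for $f$. In a one-way quantum protocol with an $m$-qubit message (and no prior entanglement), Alice on input $x$ sends an $m$-qubit mixed state $\rho_x$, and Bob on input $y$ performs on it a measurement (POVM) $\{E^y_z\}_{z\in Z}$ and outputs the outcome $z$; the average error under $\mu$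 is $\Pr[(x,y,z)\notin f]$ for $(x,y)\sim\mu$. $\mathsf{Q}^{1,\mu}_\delta(f)$ is the least $m$ for which some such protocol has average error at most $\delta$ under $\mu$. **Theorem.** Let $\epsilon\in(0,1/2)$. There are constants $c,c'>0$ that depend only on $\epsilon$ such that the following holds for all $X,Y,Z$ and every product distribution $\mu$ on $X\times Y$. 1. If $f:X\times Y\to Z$ is a total function with $\mathsf{rec}^{1,\mu}_\epsilon(f)>2\log(1/\epsilon)$, then $$\mathsf{Q}^{1,\mu}_{\epsilon^3/8}(f)\ \ge\ \tfrac12(1-2\epsilon)\bigl(S(\epsilon/2)-S(\epsilon/4)\bigr)\bigl(\lfloor\mathsf{rec}^{1,\mu}_\epsilon(f)\rfloor-1\bigr)\ \ge\ c\cdot\mathsf{rec}^{1,\mu}_\epsilon(f).$$ 2. If $f:X\times Y\to Z\cup\{*\}$ is a partial function with $\mathsf{rec}^{1,\mu}_\epsilon(f)>2\log(1/\epsilon)$, then $$\mathsf{Q}^{1,\mu}_{\epsilon^6/(2\cdot 15^4)}(f)\ \ge\ \tfrac12(1-2\epsilon)\,\frac{\epsilon^2}{300}\,\bigl(\lfloor\mathsf{rec}^{1,\mu}_\epsilon(f)\rfloor-1\bigr)\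 \ge\ c'\cdot\mathsf{rec}^{1,\mu}_\epsilon(f).$$ -/

import Mathlib

open scoped ComplexOrder

namespace OneWayComm

noncomputable section

/-! ### Distributions on finite sets

A probability distribution on a finite type `Ω` is an element of `stdSimplex ℝ Ω`. -/

/-- The probability of the event `E` under the distribution `μ`. -/
def prob {Ω : Type*} [Fintype Ω] (μ : Ω → ℝ) (E : Set Ω) : ℝ :=
  ∑ ω, E.indicator μ ω

/-- The distribution `μ` conditioned on the event `E` (meaningful when `0 < prob μ E`). -/
def condDist {Ω : Type*} [Fintype Ω] (μ : Ω → ℝ) (E : Set Ω) : Ω → ℝ :=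
  fun ω => E.indicator μ ω / prob μ E

/-- `μ` is a probability distribution on `X × Y` that is a product `p ⊗ q` of probability
distributions `p` on `X` and `q` on `Y`. -/
def IsProductDistribution {X Y : Type*} [Fintype X] [Fintype Y] (μ : X × Y → ℝ) : Prop :=
  ∃ p ∈ stdSimplex ℝ X, ∃ q ∈ stdSimplex ℝ Y, ∀ x y, μ (x, y) = p x * q y

/-- The binary entropy function, with logarithms to base two. -/
def binaryEntropy (p : ℝ) : ℝ :=
  -p * Real.logb 2 p - (1 - p) * Real.logb 2 (1 - p)

/-! ### Total and partial functions as relations `f ⊆ X × Y × Z` -/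

/-- The relation of a total function: the only correct answer on `(x, y)` is `f (x, y)`. -/
def totalRel {X Y Z : Type*} (f : X × Y → Z) : Set (X × Y × Z) :=
  {t | f (t.1, t.2.1) = t.2.2}

/-- The relation of a partial function, where `none` stands for the undefined value `*`:
on inputs with value `*` every answer is correct, on the others only the value of `f`. -/
def partialRel {X Y Z : Type*} (f : X × Y → Option Z) : Set (X × Y × Z) :=
  {t | f (t.1, t.2.1) = none ∨ f (t.1, t.2.1) = some t.2.2}

/-! ### The one-way rectangle bound -/

/-- A one-way rectangle is a set `S × Y` with `S ⊆ X`. -/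
def IsOneWayRectangle {X Y : Type*} (R : Set (X × Y)) : Prop :=
  ∃ S : Set X, R = S ×ˢ Set.univ

/-- `ν` is one-way `ε`-monochromatic for the relation `f`: for some `g : Y → Z`, the answer
`g y` is correct with probability at least `1 - ε` when `(x, y)` is drawn from `ν`. -/
def IsOneWayMonochromatic {X Y Z : Type*} [Fintype X] [Fintype Y] (ε : ℝ)
    (f : Set (X × Y × Z)) (ν : X × Y → ℝ) : Prop :=
  ∃ g : Y → Z, 1 - ε ≤ prob ν {p | (p.1, p.2, g p.2) ∈ f}

/-- The one-way rectangle bound: the minimum of `log₂ (1 / μ(R))` over the one-way rectangles `R`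
of positive probability such that `μ` conditioned on `R` is one-way `ε`-monochromatic for `f`.
(As `X` is finite, only finitely many values occur; if `μ` is a distribution and each input has
a correct answer, the rectangles `{x} × Y` show that there is at least one when `0 ≤ ε`.) -/
def rec1 {X Y Z : Type*} [Fintype X] [Fintype Y] (ε : ℝ) (μ : X × Y → ℝ)
    (f : Set (X × Y × Z)) : ℝ :=
  sInf {t | ∃ R : Set (X × Y), IsOneWayRectangle R ∧ 0 < prob μ R ∧
    IsOneWayMonochromatic ε f (condDist μ R) ∧ t = Real.logb 2 (1 / prob μ R)}

/-! ### One-way quantum protocols -/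

/-- Operators on the state space of `m` qubits, in the computational basis. -/
abbrev QubitOp (m : ℕ) : Type := Matrix (Fin m → Fin 2) (Fin m → Fin 2) ℂ

/-- A one-way quantum protocol (without prior entanglement) whose message has `m` qubits.
On input `x` Alice prepares the, possibly mixed, state `state x` and sends it to Bob; on input
`y` Bob performs the measurement `povm y` with outcomes in `Z` and outputs the outcome. -/
structure QProtocol (X Y Z : Type*) [Fintype Z] (m : ℕ) where
  /-- Alice's message on input `x`. -/
  state : X → QubitOp m
  state_posSemidef : ∀ x, (state x).PosSemidef
  state_trace : ∀ x, (state x).trace = 1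
  /-- Bob's measurement on input `y`. -/
  povm : Y → Z → QubitOp m
  povm_posSemidef : ∀ y z, (povm y z).PosSemidef
  povm_sum : ∀ y, ∑ z, povm y z = 1

/-- The probability `Tr (E ρ)` that Bob outputs `z` on inputs `x`, `y`. -/
def QProtocol.outProb {X Y Z : Type*} [Fintype Z] {m : ℕ} (P : QProtocol X Y Z m)
    (x : X) (y : Y) (z : Z) : ℝ :=
  (P.povm y z * P.state x).trace.re

/-- The average error of a protocol for the relation `f` over inputs drawn from `μ`. -/
def QProtocol.avgError {X Y Z : Type*} [Fintype X] [Fintype Y] [Fintype Z] {m : ℕ}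
    (P : QProtocol X Y Z m) (μ : X × Y → ℝ) (f : Set (X × Y × Z)) : ℝ :=
  ∑ p : X × Y, μ p * ∑ z, {z | (p.1, p.2, z) ∉ f}.indicator (P.outProb p.1 p.2) z

/-- The distributional one-way quantum communication complexity: the least number of qubits in
the message of a one-way quantum protocol with average error at most `δ` under `μ`.
(As `X` is finite, there is such a number when `0 ≤ δ` and each input has a correct answer.) -/
def Q1 {X Y Z : Type*} [Fintype X] [Fintype Y] [Fintype Z] (δ : ℝ) (μ : X × Y → ℝ)
    (f : Set (X × Y × Z)) : ℕ :=
  sInf {m | ∃ P : QProtocol X Y Z m, P.avgError μ f ≤ δ}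

end

end OneWayComm

namespace OneWayComm

open Real Matrix

/-! ### Scalar inequalities -/

-- Fix a protocol with `m` qubits and small error. For a set `A` of Alice's inputs let Φ(A) be p(A)
-- times the von Neumann entropy of her message averaged over `A`; for the set of all inputs this is
-- at most `m` bits. If p(A) exceeds 2 to the minus rectangle bound, then A × Y is not monochromatic
-- (`error_of_lt_rec1`), so even answering with the most frequent value at each `y` fails
-- noticeably. If the protocol also errs little on `A`, averaging yields one `y` at which f(·, y) is
-- far from constant on `A` while Bob is nearly always right. Cut `A` according to whether f(x, y)
-- lies in a suitable `W ⊆ Z`, outside `W`, or is undefined. Bob's outcome nearly tells the first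
-- two parts apart, so by Holevo and Fano Φ drops by a fixed gain times p(A) (`exists_good_split`).
--
-- Iterating gives a ternary tree whose leaves are light or have large error. By Markov the latter
-- have total mass at most `ε`, so the entropy of the leaf is at least (1 - ε) times the rectangle
-- bound. A ternary split contributes at most two bits, hence the expected depth is at least half of
-- that; the total drop, gain times expected depth, is at most `m`
-- (`potential_ge_of_recursive_split`, `QProtocol.rec1_le_qubits`).
--
-- Holevo's bound follows from monotonicity of relative entropy under a two-outcome measurement
-- (`relEntropy_measured_le`). The scalar a log(a/b) - a + b is an integral over `t` of quadratic
-- kernels. For each `t` the quantum version of the kernel dominates a concave quadratic expression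
-- in an arbitrary Hermitian `B`; the choice B = βE + γ(1 - E), with E² ≤ E and the optimal β and γ,
-- gives the kernel of the measured distributions.

/-- The kernel of the integral representation of the scalar relative entropy. -/
noncomputable def relEntKernel (a b t : ℝ) : ℝ := (1 - t) * ((a - b) ^ 2 / ((1 - t) * b + t * a))

theorem hasIntegral_relEntKernel {a b : ℝ} (ha : 0 ≤ a) (hb : 0 ≤ b) (hab : b = 0 → a = 0) :
    IntervalIntegrable (relEntKernel a b) MeasureTheory.volume 0 1 ∧
      ∫ t in (0 : ℝ)..1, relEntKernel a b t = a * log a - a * log b - a + b := by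
  rcases hb.eq_or_lt with rfl | hb
  · obtain rfl := hab rfl
    have h : relEntKernel 0 0 = fun _ => 0 := by
      funext t; simp [relEntKernel]
    simp [h]
  rcases ha.eq_or_lt with rfl | ha
  -- For a = 0 the kernel is the constant `b` except at t = 1, where division by zero makes it 0;
  -- hence the open interval.
  · have h : Set.EqOn (fun _ => b) (relEntKernel 0 b) (Set.uIoo 0 1) := by
      intro t ht
      rw [Set.uIoo_of_le zero_le_one] at ht
      have : 1 - t ≠ 0 := by linarith [ht.2]
      simp only [relEntKernel]
      field_simp
      ring
    refine ⟨(intervalIntegrable_const (c := b)).congr_uIoo h, ?_⟩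
    rw [← intervalIntegral.integral_congr_uIoo h]
    simp
  have hd : ∀ t ∈ Set.uIcc (0 : ℝ) 1, 0 < (1 - t) * b + t * a := by
    intro t ht
    rw [Set.uIcc_of_le zero_le_one] at ht
    rcases ht.1.eq_or_lt with rfl | h
    · simpa using hb
    · have := mul_nonneg (sub_nonneg.2 ht.2) hb.le
      have := mul_pos h ha
      linarith
  have hint : IntervalIntegrable (relEntKernel a b) MeasureTheory.volume 0 1 := by
    apply ContinuousOn.intervalIntegrable
    unfold relEntKernel
    refine ContinuousOn.mul (by fun_prop) (ContinuousOn.div (by fun_prop) (by fun_prop) ?_)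
    exact fun t ht => (hd t ht).ne'
  refine ⟨hint, ?_⟩
  have hder : ∀ t ∈ Set.uIcc (0 : ℝ) 1,
      HasDerivAt (fun t => a * log ((1 - t) * b + t * a) - (a - b) * t) (relEntKernel a b t) t := by
    intro t ht
    have h1 : HasDerivAt (fun t : ℝ => (1 - t) * b + t * a) (a - b) t := by
      have := ((((hasDerivAt_id t).const_sub 1).mul_const b).add ((hasDerivAt_id t).mul_const a))
      exact this.congr_deriv (by ring)
    have h2 := ((h1.log (hd t ht).ne').const_mul a).sub ((hasDerivAt_id t).const_mul (a - b))
    refine h2.congr_deriv ?_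
    have h0 := (hd t ht).ne'
    simp only [relEntKernel]
    generalize hD : (1 - t) * b + t * a = D at h0
    field_simp
    rw [← hD]
    ring
  rw [intervalIntegral.integral_eq_sub_of_hasDerivAt hder hint]
  simp
  ring

-- Inequalities for the scalar entropy functions (natural logarithm)

theorem negMulLog_add_negMulLog_eq {a b : ℝ} (ha : 0 ≤ a) (hb : 0 ≤ b) :
    negMulLog a + negMulLog b = negMulLog (a + b) + (a + b) * binEntropy (a / (a + b)) := by
  rcases (add_nonneg ha hb).eq_or_lt with h | h
  · have h1 : a = 0 := by linarith
    have h2 : b = 0 := by linarith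
    simp [h1, h2]
  have e1 := negMulLog_mul (a + b) (a / (a + b))
  have e2 := negMulLog_mul (a + b) (1 - a / (a + b))
  have e3 : (a + b) * (a / (a + b)) = a := by field_simp
  have e4 : (a + b) * (1 - a / (a + b)) = b := by field_simp; ring
  rw [e3] at e1
  rw [e4] at e2
  rw [binEntropy_eq_negMulLog_add_negMulLog_one_sub, e1, e2]
  ring

theorem negMulLog_add_le {a b : ℝ} (ha : 0 ≤ a) (hb : 0 ≤ b) :
    negMulLog a + negMulLog b ≤ negMulLog (a + b) + (a + b) * log 2 := by
  rw [negMulLog_add_negMulLog_eq ha hb]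
  gcongr
  exact binEntropy_le_log_two

theorem negMulLog_add_ge {a b : ℝ} (ha : 0 ≤ a) (hb : 0 ≤ b) :
    negMulLog (a + b) ≤ negMulLog a + negMulLog b := by
  rw [negMulLog_add_negMulLog_eq ha hb]
  have := binEntropy_nonneg (p := a / (a + b)) (by positivity)
    (div_le_one_of_le₀ (by linarith) (by linarith))
  have := mul_nonneg (add_nonneg ha hb) this
  linarith

theorem negMulLog_sum_le {ι : Type*} (s : Finset ι) (a : ι → ℝ) (ha : ∀ i ∈ s, 0 ≤ a i) :
    negMulLog (∑ i ∈ s, a i) ≤ ∑ i ∈ s, negMulLog (a i) := by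
  classical
  induction s using Finset.induction_on with
  | empty => simp
  | insert i s his ih =>
    rw [Finset.sum_insert his, Finset.sum_insert his]
    have h1 := ha i (Finset.mem_insert_self i s)
    have h2 : ∀ j ∈ s, 0 ≤ a j := fun j hj => ha j (Finset.mem_insert_of_mem hj)
    have := negMulLog_add_ge h1 (Finset.sum_nonneg h2)
    have := ih h2
    linarith

theorem binEntropy_concave {x y a b : ℝ} (hx : x ∈ Set.Icc (0 : ℝ) 1) (hy : y ∈ Set.Icc (0 : ℝ) 1)
    (ha : 0 ≤ a) (hb : 0 ≤ b) (hab : a + b = 1) :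
    a * binEntropy x + b * binEntropy y ≤ binEntropy (a * x + b * y) :=
  strictConcave_binEntropy.concaveOn.2 hx hy ha hb hab

/-- The perspective of the binary entropy function is superadditive: conditioning reduces
entropy. -/
theorem perspective_binEntropy_add_le {a b c d : ℝ} (ha : 0 ≤ a) (hb : 0 ≤ b) (hc : 0 ≤ c)
    (hd : 0 ≤ d) :
    (a + b) * binEntropy (a / (a + b)) + (c + d) * binEntropy (c / (c + d)) ≤
      (a + b + (c + d)) * binEntropy ((a + c) / (a + b + (c + d))) := by
  rcases (add_nonneg ha hb).eq_or_lt with h | h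
  · have h1 : a = 0 := by linarith
    have h2 : b = 0 := by linarith
    simp [h1, h2]
  rcases (add_nonneg hc hd).eq_or_lt with h' | h'
  · have h1 : c = 0 := by linarith
    have h2 : d = 0 := by linarith
    simp [h1, h2]
  have hs : 0 < a + b + (c + d) := by linarith
  have key := binEntropy_concave
    (x := a / (a + b)) ⟨by positivity, div_le_one_of_le₀ (by linarith) h.le⟩
    (y := c / (c + d)) ⟨by positivity, div_le_one_of_le₀ (by linarith) h'.le⟩
    (a := (a + b) / (a + b + (c + d))) (b := (c + d) / (a + b + (c + d)))
    (by positivity) (by positivity) (by field_simp)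
  have e : (a + b) / (a + b + (c + d)) * (a / (a + b)) +
      (c + d) / (a + b + (c + d)) * (c / (c + d)) = (a + c) / (a + b + (c + d)) := by
    field_simp
  rw [e] at key
  have := mul_le_mul_of_nonneg_left key hs.le
  refine le_trans (le_of_eq ?_) this
  field_simp

/-- Fano's inequality for the (unnormalised) joint distribution `a, b, c, d` of two bits: the
mutual information is at least the entropy of the first bit minus the entropy of the error. -/
theorem fano_two_bits {a b c d : ℝ} (ha : 0 ≤ a) (hb : 0 ≤ b) (hc : 0 ≤ c) (hd : 0 ≤ d) :
    (a + b + c + d) * (binEntropy ((a + b) / (a + b + c + d)) -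
        binEntropy ((b + c) / (a + b + c + d))) ≤
      (negMulLog (a + c) + negMulLog (b + d)) -
        (negMulLog a + negMulLog b + negMulLog c + negMulLog d) +
        (negMulLog (a + b) + negMulLog (c + d)) - negMulLog (a + b + c + d) := by
  have h1 := negMulLog_add_negMulLog_eq hc ha
  have h2 := negMulLog_add_negMulLog_eq hb hd
  have h3 := negMulLog_add_negMulLog_eq (add_nonneg ha hb) (add_nonneg hc hd)
  -- Given the outcome, the first bit and the error bit have the same entropy. Forgetting the
  -- outcome can only increase the entropy of the error bit.
  have h4 := perspective_binEntropy_add_le hc ha hb hd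
  rw [show c + a + (b + d) = a + b + c + d by ring, add_comm c b] at h4
  rw [show a + b + (c + d) = a + b + c + d by ring] at h3
  rw [add_comm c a] at h1 h4
  linarith

theorem mul_binEntropy_div_le {a c : ℝ} (ha : 0 < a) (ha1 : a ≤ 1) (hc : 0 ≤ c) (hca : c ≤ a) :
    a * binEntropy (c / a) ≤ binEntropy c := by
  have key := binEntropy_concave
    (x := c / a) ⟨by positivity, div_le_one_of_le₀ hca ha.le⟩ (y := 0) ⟨le_rfl, zero_le_one⟩
    (a := a) (b := 1 - a) ha.le (by linarith) (by ring)
  simp only [binEntropy_zero, mul_zero, add_zero] at key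
  rwa [mul_div_cancel₀ _ ha.ne'] at key

/-- By concavity the graph lies above the chord from 0 to 1/2. -/
theorem two_mul_log_two_le_binEntropy {x : ℝ} (hx0 : 0 ≤ x) (hx1 : x ≤ 1 / 2) :
    2 * x * log 2 ≤ binEntropy x := by
  have key := binEntropy_concave
    (x := 2⁻¹) ⟨by norm_num, by norm_num⟩ (y := 0) ⟨le_rfl, zero_le_one⟩
    (a := 2 * x) (b := 1 - 2 * x) (by linarith) (by linarith) (by ring)
  simp only [binEntropy_zero, mul_zero, add_zero, binEntropy_two_inv] at key
  rwa [show 2 * x * 2⁻¹ = x by ring] at key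

/-- With η = `negMulLog`: η(x²) = 2xη(x) ≤ 2x(1 - x), and η(1 - x²) ≤ x². -/
theorem binEntropy_sq_le {x : ℝ} (hx0 : 0 ≤ x) (hx1 : x ≤ 1) : binEntropy (x ^ 2) ≤ 2 * x := by
  rw [binEntropy_eq_negMulLog_add_negMulLog_one_sub]
  have h1 := negMulLog_le_one_sub_self (x := 1 - x ^ 2) (by nlinarith)
  have h2 := negMulLog_le_one_sub_self hx0
  have h3 := negMulLog_mul x x
  rw [← sq] at h3
  nlinarith

theorem binEntropy_le_of_mem_Icc {x τ : ℝ} (h0 : 0 ≤ τ) (h1 : τ ≤ x) (h2 : x ≤ 1 - τ) :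
    binEntropy τ ≤ binEntropy x := by
  rcases le_total x 2⁻¹ with h | h
  · exact binEntropy_strictMonoOn.monotoneOn ⟨h0, h1.trans h⟩ ⟨h0.trans h1, h⟩ h1
  · rw [← binEntropy_one_sub x]
    exact binEntropy_strictMonoOn.monotoneOn ⟨h0, by linarith⟩
      ⟨by linarith, by linarith [inv_eq_one_div (2 : ℝ)]⟩ (by linarith)

theorem binaryEntropy_eq (p : ℝ) : binaryEntropy p = binEntropy p / log 2 := by
  rw [binEntropy_eq_negMulLog_add_negMulLog_one_sub]
  simp only [binaryEntropy, Real.logb, negMulLog]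
  ring

/-- A weight on a finite set none of whose elements is too heavy can be cut into two heavy
parts. -/
theorem exists_balanced_subset {Z : Type*} [Fintype Z] (w : Z → ℝ) {τ : ℝ}
    (h3 : 3 * τ ≤ ∑ z, w z) (h1 : ∀ z, τ ≤ ∑ z, w z - w z) (h0 : 0 ≤ τ) :
    ∃ W : Finset Z, τ ≤ ∑ z ∈ W, w z ∧ τ ≤ ∑ z, w z - ∑ z ∈ W, w z := by
  classical
  by_cases hM : ∃ z, τ ≤ w z
  · obtain ⟨z, hz⟩ := hM
    exact ⟨{z}, by simpa using hz, by simpa using h1 z⟩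
  push Not at hM
  -- All weights are below `τ`, so adding elements one at a time cannot jump over the interval [τ,
  -- 2τ]. A total of at least `3τ` then leaves `τ` outside.
  have key : ∀ s : Finset Z, τ ≤ ∑ z ∈ s, w z →
      ∃ W : Finset Z, τ ≤ ∑ z ∈ W, w z ∧ ∑ z ∈ W, w z ≤ 2 * τ := by
    intro s
    induction s using Finset.induction_on with
    | empty => intro h; exact ⟨∅, h, by simpa using h0⟩
    | insert i s his ih =>
      intro h
      by_cases hs : τ ≤ ∑ z ∈ s, w z
      · exact ih hs
      · refine ⟨insert i s, h, ?_⟩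
        rw [Finset.sum_insert his]
        linarith [hM i]
  obtain ⟨W, hW1, hW2⟩ := key Finset.univ (by linarith)
  exact ⟨W, hW1, by linarith⟩

section Entropy

variable {n : Type*} [Fintype n] [DecidableEq n]

/-! ### Traces and spectral decompositions -/

theorem exists_spectral {M : Matrix n n ℂ} (hM : M.IsHermitian) :
    ∃ U : Matrix n n ℂ, Uᴴ * U = 1 ∧ U * Uᴴ = 1 ∧
      M = U * diagonal (fun i => (hM.eigenvalues i : ℂ)) * Uᴴ := by
  refine ⟨hM.eigenvectorUnitary, ?_, ?_, ?_⟩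
  · exact Unitary.coe_star_mul_self hM.eigenvectorUnitary
  · exact Unitary.coe_mul_star_self hM.eigenvectorUnitary
  · conv_lhs => rw [hM.spectral_theorem]
    rfl

theorem trace_diagonal_mul_mul_conjTranspose (l : n → ℝ) (A B : Matrix n n ℂ) :
    (diagonal (fun i => (l i : ℂ)) * (A * Bᴴ)).trace =
      ∑ i, ∑ j, (l i : ℂ) * (A i j * star (B i j)) := by
  simp only [trace, diag_apply, diagonal_mul]
  simp [Matrix.mul_apply, Finset.mul_sum]

theorem trace_diagonal_mul_conjTranspose_mul (l : n → ℝ) (A B : Matrix n n ℂ) :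
    (diagonal (fun i => (l i : ℂ)) * (Bᴴ * A)).trace =
      ∑ i, ∑ j, (l j : ℂ) * (A i j * star (B i j)) := by
  rw [Finset.sum_comm]
  simp only [trace, diag_apply, diagonal_mul]
  simp [Matrix.mul_apply, Finset.mul_sum, mul_comm]

theorem trace_mul_re_nonneg {A B : Matrix n n ℂ} (hA : A.PosSemidef) (hB : B.PosSemidef) :
    0 ≤ (A * B).trace.re := by
  obtain ⟨U, -, -, h⟩ := exists_spectral hA.1
  have h1 : (A * B).trace =
      (diagonal (fun i => (hA.1.eigenvalues i : ℂ)) * (Uᴴ * B * U)).trace := by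
    conv_lhs => rw [h]
    rw [Matrix.mul_assoc, Matrix.mul_assoc, trace_mul_comm]
    simp only [Matrix.mul_assoc]
  rw [h1]
  simp only [trace, diag_apply, diagonal_mul, Complex.re_sum]
  refine Finset.sum_nonneg fun i _ => ?_
  rw [Complex.re_ofReal_mul]
  exact mul_nonneg (hA.eigenvalues_nonneg i)
    (Complex.le_def.1 (hB.conjTranspose_mul_mul_same U).diag_nonneg).1

theorem trace_re_eq_sum_eigenvalues {M : Matrix n n ℂ} (hM : M.IsHermitian) :
    M.trace.re = ∑ i, hM.eigenvalues i := by
  rw [hM.trace_eq_sum_eigenvalues, Complex.re_sum]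
  simp

-- Monotonicity of the quadratic relative entropy

/-- Completing the square in `b`: the difference is |a w - m b|² / m. This is the entrywise form of
the variational bound. -/
theorem two_mul_re_sub_le {a m : ℝ} (hm : 0 ≤ m) (h0 : m = 0 → a = 0) (w b : ℂ) :
    2 * (a * (w * star b).re) - m * Complex.normSq b ≤ Complex.normSq w * (a ^ 2 / m) := by
  rcases hm.eq_or_lt with rfl | hm
  · simp [h0 rfl]
  · rw [mul_div_assoc', le_div_iff₀ hm]
    simp only [Complex.normSq_apply, Complex.star_def, Complex.mul_re, Complex.conj_re,
      Complex.conj_im]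
    nlinarith [sq_nonneg (a * w.re - m * b.re), sq_nonneg (a * w.im - m * b.im)]

/-- The variational bound for the quadratic relative entropy in joint eigenbases. -/
theorem sum_relEntKernel_ge {l k : n → ℝ} (hl : ∀ i, 0 ≤ l i) (hk : ∀ i, 0 ≤ k i)
    {U V : Matrix n n ℂ} (hU : U * Uᴴ = 1) (hV : V * Vᴴ = 1)
    {ρ σ : Matrix n n ℂ} (hρ : ρ = U * diagonal (fun i => (l i : ℂ)) * Uᴴ)
    (hσ : σ = V * diagonal (fun i => (k i : ℂ)) * Vᴴ)
    {B : Matrix n n ℂ} (hB : B.IsHermitian) {t : ℝ} (ht0 : 0 < t) (ht1 : t < 1) :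
    (1 - t) * (2 * ((ρ * B).trace.re - (σ * B).trace.re) - t * (ρ * (B * B)).trace.re -
        (1 - t) * (σ * (B * B)).trace.re) ≤
      ∑ i, ∑ j, Complex.normSq ((Uᴴ * V) i j) * relEntKernel (l i) (k j) t := by
  -- Written between the eigenbases of `ρ` and `σ`, all four traces become sums over pairs (i, j),
  -- and the inequality can be checked entry by entry.
  set b := Uᴴ * B * V with hb
  have hbH : bᴴ = Vᴴ * B * U := by
    simp [hb, conjTranspose_mul, hB.eq, Matrix.mul_assoc]
  have e1 : (ρ * B).trace = (diagonal (fun i => (l i : ℂ)) * ((Uᴴ * V) * bᴴ)).trace := by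
    rw [hρ, hbH, Matrix.mul_assoc, Matrix.mul_assoc, trace_mul_comm]
    congr 1
    calc _ = diagonal (fun i => (l i : ℂ)) * (Uᴴ * 1 * B * U) := by
          simp only [Matrix.mul_assoc, Matrix.one_mul]
      _ = _ := by rw [← hV]; simp only [Matrix.mul_assoc]
  have e2 : (σ * B).trace = (diagonal (fun i => (k i : ℂ)) * (bᴴ * (Uᴴ * V))).trace := by
    rw [hσ, hbH, Matrix.mul_assoc, Matrix.mul_assoc, trace_mul_comm]
    congr 1
    calc _ = diagonal (fun i => (k i : ℂ)) * (Vᴴ * B * 1 * V) := by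
          simp only [Matrix.mul_assoc, Matrix.one_mul]
      _ = _ := by rw [← hU]; simp only [Matrix.mul_assoc]
  have e3 : (ρ * (B * B)).trace = (diagonal (fun i => (l i : ℂ)) * (b * bᴴ)).trace := by
    rw [hρ, hbH, hb, Matrix.mul_assoc, Matrix.mul_assoc, trace_mul_comm]
    congr 1
    calc _ = diagonal (fun i => (l i : ℂ)) * (Uᴴ * B * 1 * B * U) := by
          simp only [Matrix.mul_assoc, Matrix.one_mul]
      _ = _ := by rw [← hV]; simp only [Matrix.mul_assoc]
  have e4 : (σ * (B * B)).trace = (diagonal (fun i => (k i : ℂ)) * (bᴴ * b)).trace := by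
    rw [hσ, hbH, hb, Matrix.mul_assoc, Matrix.mul_assoc, trace_mul_comm]
    congr 1
    calc _ = diagonal (fun i => (k i : ℂ)) * (Vᴴ * B * 1 * B * V) := by
          simp only [Matrix.mul_assoc, Matrix.one_mul]
      _ = _ := by rw [← hU]; simp only [Matrix.mul_assoc]
  rw [e1, e2, e3, e4, trace_diagonal_mul_mul_conjTranspose, trace_diagonal_mul_mul_conjTranspose,
    trace_diagonal_mul_conjTranspose_mul, trace_diagonal_mul_conjTranspose_mul]
  simp only [Complex.re_sum, Complex.re_ofReal_mul, Finset.mul_sum, ← Finset.sum_sub_distrib]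
  refine Finset.sum_le_sum fun i _ => Finset.sum_le_sum fun j _ => ?_
  have h1t : 0 < 1 - t := by linarith
  have hm1 := mul_nonneg h1t.le (hk j)
  have hm2 := mul_nonneg ht0.le (hl i)
  have key := two_mul_re_sub_le (a := l i - k j) (m := (1 - t) * k j + t * l i)
    (by linarith) (fun h => by
      have h1 : (1 - t) * k j = 0 := by linarith
      have h2 : t * l i = 0 := by linarith
      rw [(mul_eq_zero.1 h1).resolve_left h1t.ne', (mul_eq_zero.1 h2).resolve_left ht0.ne']
      ring) ((Uᴴ * V) i j) (b i j)
  have hn : (b i j * star (b i j)).re = Complex.normSq (b i j) := by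
    simp [Complex.normSq_apply, Complex.mul_re]
  rw [hn]
  have := mul_le_mul_of_nonneg_left key h1t.le
  simp only [relEntKernel]
  linarith

/-- The optimal multiplier in the variational formula for the kernel. -/
theorem exists_relEntKernel_eq {a b t : ℝ} (ha : 0 ≤ a) (hb : 0 ≤ b) (ht0 : 0 < t) (ht1 : t < 1) :
    ∃ β : ℝ, relEntKernel a b t =
      (1 - t) * (2 * (a * β - b * β) - t * (a * β ^ 2) - (1 - t) * (b * β ^ 2)) := by
  have h1t : 0 < 1 - t := by linarith
  refine ⟨(a - b) / ((1 - t) * b + t * a), ?_⟩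
  simp only [relEntKernel]
  congr 1
  have hm1 := mul_nonneg h1t.le hb
  have hm2 := mul_nonneg ht0.le ha
  rcases (add_nonneg hm1 hm2).eq_or_lt with h | h
  · rw [← h]
    simp
  · have h0 := h.ne'
    have e : ∀ β : ℝ, 2 * (a * β - b * β) - t * (a * β ^ 2) - (1 - t) * (b * β ^ 2) =
        2 * (a - b) * β - ((1 - t) * b + t * a) * β ^ 2 := fun β => by ring
    rw [e]
    generalize (1 - t) * b + t * a = D at h0
    field_simp
    ring

/-- Monotonicity of the quadratic relative entropy under two-outcome measurements. -/
theorem sum_relEntKernel_ge_measured {l k : n → ℝ} (hl : ∀ i, 0 ≤ l i) (hk : ∀ i, 0 ≤ k i)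
    {U V : Matrix n n ℂ} (hU : U * Uᴴ = 1) (hV : V * Vᴴ = 1)
    {ρ σ : Matrix n n ℂ} (hρ : ρ = U * diagonal (fun i => (l i : ℂ)) * Uᴴ)
    (hσ : σ = V * diagonal (fun i => (k i : ℂ)) * Vᴴ) (hρ0 : ρ.PosSemidef) (hσ0 : σ.PosSemidef)
    {E : Matrix n n ℂ} (hE : E.PosSemidef) (hE1 : (1 - E).PosSemidef)
    {t : ℝ} (ht0 : 0 < t) (ht1 : t < 1) :
    relEntKernel (ρ * E).trace.re (σ * E).trace.re t +
        relEntKernel (ρ * (1 - E)).trace.re (σ * (1 - E)).trace.re t ≤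
      ∑ i, ∑ j, Complex.normSq ((Uᴴ * V) i j) * relEntKernel (l i) (k j) t := by
  obtain ⟨β, hβ⟩ :=
    exists_relEntKernel_eq (trace_mul_re_nonneg hρ0 hE) (trace_mul_re_nonneg hσ0 hE) ht0 ht1
  obtain ⟨γ, hγ⟩ :=
    exists_relEntKernel_eq (trace_mul_re_nonneg hρ0 hE1) (trace_mul_re_nonneg hσ0 hE1) ht0 ht1
  rw [hβ, hγ]
  have hB : ((β : ℂ) • E + (γ : ℂ) • (1 - E)).IsHermitian := by
    have h1 := hE.1
    have h2 := hE1.1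
    simp only [IsHermitian, conjTranspose_add, conjTranspose_smul, h1.eq, h2.eq] at *
    simp
  refine le_trans ?_ (sum_relEntKernel_ge hl hk hU hV hρ hσ hB ht0 ht1)
  -- E - E² = E(1 - E)E + (1 - E)E(1 - E).
  have hEE : (E - E * E).PosSemidef := by
    have h1 := hE1.conjTranspose_mul_mul_same E
    have h2 := hE.conjTranspose_mul_mul_same (1 - E)
    rw [hE.1.eq] at h1
    rw [hE1.1.eq] at h2
    have := h1.add h2
    convert this using 1
    noncomm_ring
  have hsq : ∀ {τ : Matrix n n ℂ}, τ.PosSemidef →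
      (τ * (((β : ℂ) • E + (γ : ℂ) • (1 - E)) * ((β : ℂ) • E + (γ : ℂ) • (1 - E)))).trace.re ≤
        (τ * E).trace.re * β ^ 2 + (τ * (1 - E)).trace.re * γ ^ 2 := by
    intro τ hτ
    have h1 := mul_nonneg (sq_nonneg (β - γ)) (trace_mul_re_nonneg hτ hEE)
    -- The square of βE + γ(1 - E) is β²E + γ²(1 - E) minus (β - γ)²(E - E²), and the last term has
    -- nonnegative trace against `τ`.
    have h2 : τ * (((β : ℂ) • E + (γ : ℂ) • (1 - E)) * ((β : ℂ) • E + (γ : ℂ) • (1 - E))) =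
        ((β ^ 2 : ℝ) : ℂ) • (τ * E) + ((γ ^ 2 : ℝ) : ℂ) • (τ * (1 - E)) -
          (((β - γ) ^ 2 : ℝ) : ℂ) • (τ * (E - E * E)) := by
      push_cast
      simp only [Matrix.mul_add, Matrix.add_mul, Matrix.mul_sub, Matrix.sub_mul,
        Matrix.smul_mul, Matrix.mul_smul, Matrix.one_mul, Matrix.mul_one, smul_sub, smul_add,
        smul_smul]
      module
    rw [h2]
    simp only [trace_sub, trace_add, trace_smul, smul_eq_mul, Complex.sub_re, Complex.add_re,
      Complex.re_ofReal_mul]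
    linarith
  have hlin : ∀ τ : Matrix n n ℂ, (τ * ((β : ℂ) • E + (γ : ℂ) • (1 - E))).trace.re =
      (τ * E).trace.re * β + (τ * (1 - E)).trace.re * γ := by
    intro τ
    simp only [Matrix.mul_add, Matrix.mul_smul, trace_add, trace_smul, smul_eq_mul,
      Complex.add_re, Complex.re_ofReal_mul]
    ring
  rw [hlin, hlin, ← mul_add]
  have h1t : 0 < 1 - t := by linarith
  have hr := mul_le_mul_of_nonneg_left (hsq hρ0) ht0.le
  have hs := mul_le_mul_of_nonneg_left (hsq hσ0) h1t.le
  refine mul_le_mul_of_nonneg_left ?_ h1t.le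
  linarith

/-! ### Von Neumann entropy -/

open Classical in
/-- The von Neumann entropy `-Tr (M log M)` (natural logarithm) of a Hermitian matrix. -/
noncomputable def vonNeumannEntropy (M : Matrix n n ℂ) : ℝ :=
  if h : M.IsHermitian then ∑ i, negMulLog (h.eigenvalues i) else 0

theorem vonNeumannEntropy_eq {M : Matrix n n ℂ} (h : M.IsHermitian) :
    vonNeumannEntropy M = ∑ i, negMulLog (h.eigenvalues i) := dif_pos h

/-- The factor `c` is an overlap of eigenvectors. It may vanish where `a` does not, which is why the
support condition concerns the product. -/
theorem integral_mul_relEntKernel {c a b : ℝ} (ha : 0 ≤ a) (hb : 0 ≤ b)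
    (hab : b = 0 → c * a = 0) :
    IntervalIntegrable (fun t => c * relEntKernel a b t) MeasureTheory.volume 0 1 ∧
      ∫ t in (0 : ℝ)..1, c * relEntKernel a b t = c * (a * log a - a * log b - a + b) := by
  rcases eq_or_ne c 0 with rfl | hc
  · simp
  · obtain ⟨h1, h2⟩ := hasIntegral_relEntKernel ha hb
      (fun h => (mul_eq_zero.1 (hab h)).resolve_left hc)
    exact ⟨h1.const_mul c, by rw [intervalIntegral.integral_const_mul, h2]⟩

theorem sum_normSq_row {W : Matrix n n ℂ} (hW : W * Wᴴ = 1) (i : n) :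
    ∑ j, Complex.normSq (W i j) = 1 := by
  have h := congrFun (congrFun hW i) i
  rw [Matrix.mul_apply, one_apply_eq] at h
  have h' := congrArg Complex.re h
  simpa [Complex.normSq_apply, Complex.mul_re] using h'

theorem sum_normSq_col {W : Matrix n n ℂ} (hW : Wᴴ * W = 1) (j : n) :
    ∑ i, Complex.normSq (W i j) = 1 := by
  have h := congrFun (congrFun hW j) j
  rw [Matrix.mul_apply, one_apply_eq] at h
  have h' := congrArg Complex.re h
  simpa [Complex.normSq_apply, Complex.mul_re] using h'

theorem conj_diagonal_apply_self_re (W : Matrix n n ℂ) (l : n → ℝ) (j : n) :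
    ((Wᴴ * (diagonal (fun i => (l i : ℂ)) * W)) j j).re =
      ∑ i, Complex.normSq (W i j) * l i := by
  rw [Matrix.mul_apply]
  simp only [diagonal_mul, conjTranspose_apply, Complex.re_sum]
  refine Finset.sum_congr rfl fun i _ => ?_
  simp [Complex.normSq_apply, Complex.mul_re]
  ring

/-- A two-outcome measurement does not increase the relative entropy of `ρ` to `σ ≥ ρ`. -/
theorem relEntropy_measured_le {ρ σ : Matrix n n ℂ} (hρ : ρ.PosSemidef) (hσ : σ.PosSemidef)
    (hle : (σ - ρ).PosSemidef) {V : Matrix n n ℂ} (hV : Vᴴ * V = 1) (hV' : V * Vᴴ = 1)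
    (hσV : σ = V * diagonal (fun i => (hσ.1.eigenvalues i : ℂ)) * Vᴴ)
    {E : Matrix n n ℂ} (hE : E.PosSemidef) (hE1 : (1 - E).PosSemidef) :
    -negMulLog (ρ * E).trace.re - (ρ * E).trace.re * log (σ * E).trace.re +
        (-negMulLog (ρ * (1 - E)).trace.re -
          (ρ * (1 - E)).trace.re * log (σ * (1 - E)).trace.re) ≤
      -vonNeumannEntropy ρ - ∑ j, ((Vᴴ * ρ * V) j j).re * log (hσ.1.eigenvalues j) := by
  obtain ⟨U, hU, hU', hρU⟩ := exists_spectral hρ.1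
  set l := hρ.1.eigenvalues with hl
  set k := hσ.1.eigenvalues with hk
  have hl0 : ∀ i, 0 ≤ l i := hρ.eigenvalues_nonneg
  have hk0 : ∀ i, 0 ≤ k i := hσ.eigenvalues_nonneg
  set W := Uᴴ * V with hW
  have hWH : Wᴴ = Vᴴ * U := by simp [hW, conjTranspose_mul]
  have hWW : W * Wᴴ = 1 := by
    calc W * Wᴴ = Uᴴ * (V * Vᴴ) * U := by rw [hWH, hW]; simp only [Matrix.mul_assoc]
      _ = 1 := by rw [hV', Matrix.mul_one, hU]
  have hWW' : Wᴴ * W = 1 := by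
    calc Wᴴ * W = Vᴴ * (U * Uᴴ) * V := by rw [hWH, hW]; simp only [Matrix.mul_assoc]
      _ = 1 := by rw [hU', Matrix.mul_one, hV]
  have hdiag : ∀ j, ((Vᴴ * ρ * V) j j).re = ∑ i, Complex.normSq (W i j) * l i := by
    intro j
    rw [← conj_diagonal_apply_self_re, hWH, hW]
    conv_lhs => rw [hρU]
    simp only [Matrix.mul_assoc]
  have hdiagσ : ∀ j, ((Vᴴ * σ * V) j j).re = k j := by
    intro j
    have : Vᴴ * σ * V = diagonal (fun i => (k i : ℂ)) := by
      calc Vᴴ * σ * V = (Vᴴ * V) * diagonal (fun i => (k i : ℂ)) * (Vᴴ * V) := by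
            conv_lhs => rw [hσV]
            simp only [Matrix.mul_assoc]
        _ = _ := by rw [hV, Matrix.one_mul, Matrix.mul_one]
    rw [this]
    simp
  -- Since σ ≥ ρ, a null eigenvector of `σ` is null for `ρ`: the diagonal entry of `ρ` there is a
  -- sum of nonnegative terms squeezed to zero.
  have hsupp : ∀ i j, k j = 0 → Complex.normSq (W i j) * l i = 0 := by
    intro i j hj
    have h1 := (Complex.le_def.1 ((hle.conjTranspose_mul_mul_same V).diag_nonneg (i := j))).1
    have h2 : ((Vᴴ * (σ - ρ) * V) j j).re =
        k j - ∑ i, Complex.normSq (W i j) * l i := by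
      rw [← hdiagσ, ← hdiag, Matrix.mul_sub, Matrix.sub_mul]
      simp
    have h3 : ∀ i ∈ Finset.univ, 0 ≤ Complex.normSq (W i j) * l i :=
      fun i _ => mul_nonneg (Complex.normSq_nonneg _) (hl0 i)
    have h4 : ∑ i, Complex.normSq (W i j) * l i = 0 := by
      refine le_antisymm ?_ (Finset.sum_nonneg h3)
      rw [h2, hj] at h1
      simp only [Complex.zero_re] at h1
      linarith
    exact (Finset.sum_eq_zero_iff_of_nonneg h3).1 h4 i (Finset.mem_univ i)
  have hmeas : ∀ {F : Matrix n n ℂ}, F.PosSemidef →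
      0 ≤ (ρ * F).trace.re ∧ 0 ≤ (σ * F).trace.re ∧
        ((σ * F).trace.re = 0 → 1 * (ρ * F).trace.re = 0) := by
    intro F hF
    have h1 := trace_mul_re_nonneg hρ hF
    have h2 := trace_mul_re_nonneg hle hF
    rw [Matrix.sub_mul, trace_sub, Complex.sub_re] at h2
    exact ⟨h1, by linarith, fun h => by linarith⟩
  obtain ⟨hp0, hq0, hpq0⟩ := hmeas hE
  obtain ⟨hp1, hq1, hpq1⟩ := hmeas hE1
  obtain ⟨hi0, hI0⟩ := integral_mul_relEntKernel (c := 1) hp0 hq0 hpq0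
  obtain ⟨hi1, hI1⟩ := integral_mul_relEntKernel (c := 1) hp1 hq1 hpq1
  have hij := fun i j => integral_mul_relEntKernel (hl0 i) (hk0 j) (hsupp i j)
  -- The variational comparison needs 0 < t < 1, so the integrands are compared on the open interval
  -- only.
  have hmono := intervalIntegral.integral_mono_on_of_le_Ioo (zero_le_one' ℝ) (hi0.add hi1)
    (IntervalIntegrable.sum Finset.univ fun i _ =>
      IntervalIntegrable.sum Finset.univ fun j _ => (hij i j).1)
    (fun t ht => by
      have := sum_relEntKernel_ge_measured hl0 hk0 hU' hV' hρU hσV hρ hσ hE hE1 ht.1 ht.2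
      simpa using this)
  have e1 : ∫ t in (0 : ℝ)..1, (∑ i, ∑ j, fun t =>
      Complex.normSq (W i j) * relEntKernel (l i) (k j) t) t = ∑ i, ∑ j,
        Complex.normSq (W i j) * (l i * log (l i) - l i * log (k j) - l i + k j) := by
    simp only [Finset.sum_apply]
    rw [intervalIntegral.integral_finsetSum fun i _ => ?_]
    · refine Finset.sum_congr rfl fun i _ => ?_
      rw [intervalIntegral.integral_finsetSum fun j _ => (hij i j).1]
      exact Finset.sum_congr rfl fun j _ => (hij i j).2
    · have := IntervalIntegrable.sum Finset.univ fun j (_ : j ∈ Finset.univ) => (hij i j).1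
      simpa [Finset.sum_fn] using this
  rw [e1] at hmono
  have e2 : ∫ t in (0 : ℝ)..1, (1 * relEntKernel (ρ * E).trace.re (σ * E).trace.re t +
      1 * relEntKernel (ρ * (1 - E)).trace.re (σ * (1 - E)).trace.re t) =
      (-negMulLog (ρ * E).trace.re - (ρ * E).trace.re * log (σ * E).trace.re +
        (-negMulLog (ρ * (1 - E)).trace.re -
          (ρ * (1 - E)).trace.re * log (σ * (1 - E)).trace.re)) - ρ.trace.re + σ.trace.re := by
    rw [intervalIntegral.integral_add hi0 hi1, hI0, hI1]
    simp only [Matrix.mul_sub, Matrix.mul_one, trace_sub, Complex.sub_re, negMulLog]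
    ring
  rw [e2] at hmono
  have e3 : ∑ i, ∑ j,
      Complex.normSq (W i j) * (l i * log (l i) - l i * log (k j) - l i + k j) =
      -vonNeumannEntropy ρ - ∑ j, ((Vᴴ * ρ * V) j j).re * log (k j) -
        ρ.trace.re + σ.trace.re := by
    have s1 : ∀ g : n → ℝ, ∑ i, ∑ j, Complex.normSq (W i j) * g i = ∑ i, g i := fun g => by
      refine Finset.sum_congr rfl fun i _ => ?_
      rw [← Finset.sum_mul, sum_normSq_row hWW, one_mul]
    have s2 : ∑ i, ∑ j, Complex.normSq (W i j) * k j = ∑ j, k j := by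
      rw [Finset.sum_comm]
      refine Finset.sum_congr rfl fun i _ => ?_
      rw [← Finset.sum_mul, sum_normSq_col hWW', one_mul]
    have s3 : ∑ i, ∑ j, Complex.normSq (W i j) * (l i * log (k j)) =
        ∑ j, ((Vᴴ * ρ * V) j j).re * log (k j) := by
      rw [Finset.sum_comm]
      refine Finset.sum_congr rfl fun j _ => ?_
      rw [hdiag, Finset.sum_mul]
      exact Finset.sum_congr rfl fun i _ => by ring
    rw [vonNeumannEntropy_eq hρ.1, ← s3, trace_re_eq_sum_eigenvalues hρ.1,
      trace_re_eq_sum_eigenvalues hσ.1, ← hl, ← hk, ← s1 l, ← s2,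
      ← s1 (fun i => negMulLog (l i))]
    simp only [← Finset.sum_sub_distrib, ← Finset.sum_add_distrib, ← Finset.sum_neg_distrib]
    refine Finset.sum_congr rfl fun i _ => Finset.sum_congr rfl fun j _ => ?_
    simp only [negMulLog]
    ring
  rw [e3] at hmono
  linarith

/-- **Holevo's bound** for an ensemble of two states and a two-outcome measurement, without
normalisation. -/
theorem holevo_two {M N : Matrix n n ℂ} (hM : M.PosSemidef) (hN : N.PosSemidef)
    {E : Matrix n n ℂ} (hE : E.PosSemidef) (hE1 : (1 - E).PosSemidef) :
    negMulLog ((M * E).trace.re + (N * E).trace.re) +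
        negMulLog ((M * (1 - E)).trace.re + (N * (1 - E)).trace.re) -
        (negMulLog (M * E).trace.re + negMulLog (M * (1 - E)).trace.re +
          (negMulLog (N * E).trace.re + negMulLog (N * (1 - E)).trace.re)) ≤
      vonNeumannEntropy (M + N) - vonNeumannEntropy M - vonNeumannEntropy N := by
  have hS := hM.add hN
  obtain ⟨V, hV, hV', h⟩ := exists_spectral hS.1
  -- The Holevo quantity is D(M ‖ M + N) + D(N ‖ M + N), and each term can only decrease under the
  -- measurement.
  have hm := relEntropy_measured_le hM hS (by simpa using hN) hV hV' h hE hE1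
  have hn := relEntropy_measured_le hN hS (by simpa using hM) hV hV' h hE hE1
  have hd : ∑ j, ((Vᴴ * M * V) j j).re * log (hS.1.eigenvalues j) +
      ∑ j, ((Vᴴ * N * V) j j).re * log (hS.1.eigenvalues j) = -vonNeumannEntropy (M + N) := by
    rw [vonNeumannEntropy_eq hS.1, ← Finset.sum_add_distrib, ← Finset.sum_neg_distrib]
    refine Finset.sum_congr rfl fun j _ => ?_
    have : Vᴴ * (M + N) * V = diagonal (fun i => (hS.1.eigenvalues i : ℂ)) := by
      calc Vᴴ * (M + N) * V =
            (Vᴴ * V) * diagonal (fun i => (hS.1.eigenvalues i : ℂ)) * (Vᴴ * V) := by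
            conv_lhs => rw [h]
            simp only [Matrix.mul_assoc]
        _ = _ := by rw [hV, Matrix.one_mul, Matrix.mul_one]
    have h' := congrArg Complex.re (congrFun (congrFun this j) j)
    rw [Matrix.mul_add, Matrix.add_mul, Matrix.add_apply, Complex.add_re, diagonal_apply_eq,
      Complex.ofReal_re] at h'
    rw [← add_mul, h', negMulLog]
    ring
  simp only [Matrix.add_mul, trace_add, Complex.add_re] at hm hn
  simp only [negMulLog] at *
  linarith

/-! ### Entropy relative to the trace -/

/-- For a positive semidefinite matrix `M = p ρ` with `ρ` a state, this is `p` times the von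
Neumann entropy of `ρ`. -/
noncomputable def weightedEntropy (M : Matrix n n ℂ) : ℝ :=
  vonNeumannEntropy M - negMulLog M.trace.re

theorem weightedEntropy_nonneg {M : Matrix n n ℂ} (hM : M.PosSemidef) :
    0 ≤ weightedEntropy M := by
  rw [weightedEntropy, vonNeumannEntropy_eq hM.1, trace_re_eq_sum_eigenvalues hM.1]
  have := negMulLog_sum_le Finset.univ hM.1.eigenvalues fun i _ => hM.eigenvalues_nonneg i
  linarith

/-- The tangent bound η(x) ≤ 1 - x, for η = `negMulLog`, is applied to each eigenvalue rescaled by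
the dimension; the linear terms cancel in the sum because the trace is 1. -/
theorem weightedEntropy_le {M : Matrix n n ℂ} (hM : M.PosSemidef) (h1 : M.trace = 1) :
    weightedEntropy M ≤ log (Fintype.card n) := by
  have ht := trace_re_eq_sum_eigenvalues hM.1
  rw [h1, Complex.one_re] at ht
  rw [weightedEntropy, vonNeumannEntropy_eq hM.1, h1, Complex.one_re, negMulLog_one, sub_zero]
  have hc : 0 < (Fintype.card n : ℝ) := by
    rcases isEmpty_or_nonempty n with h | h
    · simp at ht
    · exact_mod_cast Fintype.card_pos
  have key : ∀ i, negMulLog (hM.1.eigenvalues i) ≤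
      hM.1.eigenvalues i * log (Fintype.card n) + ((Fintype.card n : ℝ)⁻¹ - hM.1.eigenvalues i) := by
    intro i
    have h0 := hM.eigenvalues_nonneg i
    have h2 := negMulLog_le_one_sub_self (mul_nonneg h0 hc.le)
    rw [negMulLog_mul] at h2
    simp only [negMulLog] at h2 ⊢
    have h3 := mul_le_mul_of_nonneg_left h2 (inv_pos.2 hc).le
    have e1 : (Fintype.card n : ℝ)⁻¹ * (Fintype.card n : ℝ) = 1 := inv_mul_cancel₀ hc.ne'
    have e2 : ∀ x y : ℝ, (Fintype.card n : ℝ)⁻¹ * ((Fintype.card n : ℝ) * x +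
        y * (-(Fintype.card n : ℝ) * log (Fintype.card n))) = x - y * log (Fintype.card n) := by
      intro x y
      linear_combination (x - y * log (Fintype.card n)) * e1
    have e3 : ∀ x : ℝ, (Fintype.card n : ℝ)⁻¹ * (1 - x * (Fintype.card n : ℝ)) =
        (Fintype.card n : ℝ)⁻¹ - x := by
      intro x
      linear_combination -x * e1
    rw [e2, e3] at h3
    linarith
  calc ∑ i, negMulLog (hM.1.eigenvalues i)
      ≤ ∑ i, (hM.1.eigenvalues i * log (Fintype.card n) +
          ((Fintype.card n : ℝ)⁻¹ - hM.1.eigenvalues i)) := Finset.sum_le_sum fun i _ => key i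
    _ = log (Fintype.card n) := by
        rw [Finset.sum_add_distrib, Finset.sum_sub_distrib, ← Finset.sum_mul, ← ht]
        simp [hc.ne']

/-- The weighted entropy exceeds that of the two parts by at least the mutual information that
Fano's inequality guarantees. -/
theorem weightedEntropy_add_ge_of_measurement {M N : Matrix n n ℂ} (hM : M.PosSemidef)
    (hN : N.PosSemidef) {E : Matrix n n ℂ} (hE : E.PosSemidef) (hE1 : (1 - E).PosSemidef) :
    weightedEntropy M + weightedEntropy N + (M.trace.re + N.trace.re) *
        (binEntropy (M.trace.re / (M.trace.re + N.trace.re)) -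
          binEntropy (((M * (1 - E)).trace.re + (N * E).trace.re) /
            (M.trace.re + N.trace.re))) ≤
      weightedEntropy (M + N) := by
  have h1 := holevo_two hM hN hE hE1
  have h2 := fano_two_bits (trace_mul_re_nonneg hM hE) (trace_mul_re_nonneg hM hE1)
    (trace_mul_re_nonneg hN hE) (trace_mul_re_nonneg hN hE1)
  have e : ∀ A : Matrix n n ℂ, (A * E).trace.re + (A * (1 - E)).trace.re = A.trace.re := by
    intro A
    rw [← Complex.add_re, ← trace_add, ← Matrix.mul_add]
    simp
  have e' : (M * E).trace.re + (M * (1 - E)).trace.re + (N * E).trace.re +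
      (N * (1 - E)).trace.re = M.trace.re + N.trace.re := by
    rw [← e M, ← e N]; ring
  rw [e', e M, e N] at h2
  simp only [weightedEntropy, trace_add, Complex.add_re]
  linarith

/-- Concavity of the von Neumann entropy, obtained from Holevo's bound for the trivial measurement E
= 1. -/
theorem weightedEntropy_add_ge {M N : Matrix n n ℂ} (hM : M.PosSemidef) (hN : N.PosSemidef) :
    weightedEntropy M + weightedEntropy N ≤ weightedEntropy (M + N) := by
  have h1 := holevo_two hM hN PosSemidef.one (by simpa using PosSemidef.zero)
  simp only [weightedEntropy, trace_add, Complex.add_re]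
  simp at h1
  linarith

end Entropy

/-! ### Recursive partitions -/

theorem sum_filter_fin_three {X : Type*} (A : Finset X) (c : X → Fin 3) (w : X → ℝ) :
    ∑ x ∈ A, w x = ∑ x ∈ A with c x = 0, w x + ∑ x ∈ A with c x = 1, w x +
      ∑ x ∈ A with c x = 2, w x := by
  rw [← Finset.sum_fiberwise A c w, Fin.sum_univ_three]

theorem negMulLog_three_le {a b c : ℝ} (ha : 0 ≤ a) (hb : 0 ≤ b) (hc : 0 ≤ c) :
    negMulLog a + negMulLog b + negMulLog c ≤
      negMulLog (a + b + c) + 2 * log 2 * (a + b + c) := by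
  have h1 := negMulLog_add_le ha hb
  have h2 := negMulLog_add_le (add_nonneg ha hb) hc
  have := mul_nonneg hc (log_nonneg one_le_two)
  linarith

/-- If every set that is neither light nor of large cost can be cut into at most three parts so
that the potential `Φ` drops by `g` times the weight, then the potential is large: the entropy of
the final partition is at most `2 log 2` times the expected depth. -/
theorem potential_ge_of_recursive_split {X : Type*} {p cost : X → ℝ} {Φ : Finset X → ℝ}
    {g r d : ℝ} (hg : 0 ≤ g) (hr : 0 ≤ r) (hd : 0 < d) (hp : ∀ x, 0 ≤ p x)
    (hcost : ∀ x, 0 ≤ cost x) (hΦ : ∀ A, 0 ≤ Φ A)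
    (hsplit : ∀ A : Finset X, 0 < ∑ x ∈ A, p x → -log (∑ x ∈ A, p x) < r →
      ∑ x ∈ A, cost x < d * ∑ x ∈ A, p x →
      ∃ c : X → Fin 3, (∀ i, {x ∈ A | c x = i} ≠ A) ∧
        Φ {x ∈ A | c x = 0} + Φ {x ∈ A | c x = 1} + Φ {x ∈ A | c x = 2} +
          g * ∑ x ∈ A, p x ≤ Φ A)
    (A : Finset X) (hA : ∑ x ∈ A, p x ≤ 1) :
    g * (r * (∑ x ∈ A, p x - (∑ x ∈ A, cost x) / d) - negMulLog (∑ x ∈ A, p x)) ≤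
      2 * log 2 * Φ A := by
  induction A using Finset.strongInduction with
  | H A ih =>
    have hp0 : 0 ≤ ∑ x ∈ A, p x := Finset.sum_nonneg fun x _ => hp x
    have hc0 : 0 ≤ (∑ x ∈ A, cost x) / d := div_nonneg (Finset.sum_nonneg fun x _ => hcost x) hd.le
    have hR : 0 ≤ 2 * log 2 * Φ A := mul_nonneg (by positivity) (hΦ A)
    have hη := negMulLog_nonneg hp0 hA
    rcases hp0.eq_or_lt with h0 | h0
    · refine le_trans (mul_nonpos_of_nonneg_of_nonpos hg ?_) hR
      have := mul_nonneg hr hc0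
      rw [← h0, negMulLog_zero]
      linarith
    by_cases h1 : -log (∑ x ∈ A, p x) < r
    · by_cases h2 : ∑ x ∈ A, cost x < d * ∑ x ∈ A, p x
      · obtain ⟨c, hc, hdrop⟩ := hsplit A h0 h1 h2
        -- Each part is a proper subset, so the induction applies. A ternary split is two binary
        -- ones, each worth at most log 2 per unit of weight, which accounts for the factor `2 log
        -- 2`.
        have hi : ∀ i, g * (r * (∑ x ∈ A with c x = i, p x -
            (∑ x ∈ A with c x = i, cost x) / d) - negMulLog (∑ x ∈ A with c x = i, p x)) ≤
            2 * log 2 * Φ {x ∈ A | c x = i} := fun i => by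
          refine ih _ ((Finset.filter_subset _ _).ssubset_of_ne (hc i)) (le_trans ?_ hA)
          exact Finset.sum_le_sum_of_subset_of_nonneg (Finset.filter_subset _ _)
            fun x _ _ => hp x
        have hn : ∀ i, 0 ≤ ∑ x ∈ A with c x = i, p x := fun i => Finset.sum_nonneg fun x _ => hp x
        have h3 := mul_le_mul_of_nonneg_left (negMulLog_three_le (hn 0) (hn 1) (hn 2)) hg
        have h4 := mul_le_mul_of_nonneg_left hdrop (by positivity : 0 ≤ 2 * log 2)
        have i0 := hi 0
        have i1 := hi 1
        have i2 := hi 2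
        rw [sum_filter_fin_three A c p] at h4 ⊢
        rw [sum_filter_fin_three A c cost, add_div, add_div]
        linarith
      -- A leaf of large cost: its weight is at most cost / d, so the left side is not positive.
      -- This is where Markov's inequality is built into the potential.
      · refine le_trans (mul_nonpos_of_nonneg_of_nonpos hg ?_) hR
        have : ∑ x ∈ A, p x ≤ (∑ x ∈ A, cost x) / d := by
          rw [le_div_iff₀ hd]; linarith
        have := mul_nonneg hr (sub_nonneg.2 this)
        linarith
    -- A light leaf: its entropy term is already at least `r` times its weight.
    · refine le_trans (mul_nonpos_of_nonneg_of_nonpos hg ?_) hR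
      push Not at h1
      have h2 := mul_le_mul_of_nonneg_left h1 hp0
      have h3 := mul_nonneg hr hc0
      simp only [negMulLog]
      linarith

/-! ### Protocols -/

section Protocol

open Classical

/-- The error probability of a protocol on inputs `x`, `y`. -/
noncomputable def QProtocol.errProb {X Y Z : Type*} [Fintype Z] {m : ℕ} (P : QProtocol X Y Z m)
    (f : Set (X × Y × Z)) (x : X) (y : Y) : ℝ :=
  ∑ z, {z | (x, y, z) ∉ f}.indicator (P.outProb x y) z

theorem sum_valueWeight {X Y Z : Type*} (p : X → ℝ) (f : X × Y → Option Z) (y : Y)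
    (A : Finset X) (W : Finset Z) :
    ∑ z ∈ W, ∑ x ∈ A, (if f (x, y) = some z then p x else 0) =
      ∑ x ∈ A with ∃ z ∈ W, f (x, y) = some z, p x := by
  rw [Finset.sum_comm, Finset.sum_filter]
  refine Finset.sum_congr rfl fun x _ => ?_
  rcases f (x, y) with _ | z <;> simp

variable {X Y Z : Type*} [Fintype Z] {m : ℕ} (P : QProtocol X Y Z m) (p : X → ℝ)

theorem QProtocol.outProb_nonneg (x : X) (y : Y) (z : Z) : 0 ≤ P.outProb x y z :=
  trace_mul_re_nonneg (P.povm_posSemidef y z) (P.state_posSemidef x)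

theorem QProtocol.sum_outProb_le_errProb {f : Set (X × Y × Z)} {x : X} {y : Y} {V : Finset Z}
    (hV : ∀ z ∈ V, (x, y, z) ∉ f) : ∑ z ∈ V, P.outProb x y z ≤ P.errProb f x y := by
  calc ∑ z ∈ V, P.outProb x y z
      = ∑ z ∈ V, {z | (x, y, z) ∉ f}.indicator (P.outProb x y) z :=
        Finset.sum_congr rfl fun z hz => (Set.indicator_of_mem (hV z hz) _).symm
    _ ≤ _ := Finset.sum_le_sum_of_subset_of_nonneg (Finset.subset_univ V) fun z _ _ =>
        Set.indicator_nonneg (fun z _ => P.outProb_nonneg x y z) z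

theorem QProtocol.errProb_nonneg (f : Set (X × Y × Z)) (x : X) (y : Y) : 0 ≤ P.errProb f x y :=
  Finset.sum_nonneg fun z _ => Set.indicator_nonneg (fun z _ => P.outProb_nonneg x y z) z

/-- The message averaged over the inputs in `A`, without normalisation. -/
noncomputable def QProtocol.mixture (A : Finset X) : QubitOp m :=
  ∑ x ∈ A, (p x : ℂ) • P.state x

variable {p}

theorem QProtocol.mixture_posSemidef (hp : ∀ x, 0 ≤ p x) (A : Finset X) :
    (P.mixture p A).PosSemidef :=
  posSemidef_sum (x := fun x => (p x : ℂ) • P.state x) A fun x _ =>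
    (P.state_posSemidef x).smul (Complex.zero_le_real.2 (hp x))

variable (p)

theorem QProtocol.trace_mixture (A : Finset X) :
    (P.mixture p A).trace = ((∑ x ∈ A, p x : ℝ) : ℂ) := by
  simp only [QProtocol.mixture, Matrix.trace_sum, trace_smul, P.state_trace, smul_eq_mul, mul_one,
    Complex.ofReal_sum]

theorem QProtocol.trace_mixture_mul (A : Finset X) (y : Y) (V : Finset Z) :
    (P.mixture p A * ∑ z ∈ V, P.povm y z).trace.re =
      ∑ x ∈ A, p x * ∑ z ∈ V, P.outProb x y z := by
  rw [QProtocol.mixture, Finset.sum_mul, Matrix.trace_sum, Complex.re_sum]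
  refine Finset.sum_congr rfl fun x _ => ?_
  rw [Matrix.smul_mul, trace_smul, smul_eq_mul, Complex.re_ofReal_mul, Finset.mul_sum,
    Matrix.trace_sum, Complex.re_sum]
  congr 1
  refine Finset.sum_congr rfl fun z _ => ?_
  rw [QProtocol.outProb, trace_mul_comm]

theorem QProtocol.mixture_fin_three (A : Finset X) (c : X → Fin 3) :
    P.mixture p A = P.mixture p {x ∈ A | c x = 0} + P.mixture p {x ∈ A | c x = 1} +
      P.mixture p {x ∈ A | c x = 2} := by
  simp only [QProtocol.mixture]
  rw [← Finset.sum_fiberwise A c, Fin.sum_univ_three]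

/-- The colour of `x`: whether the value of `f` at `(x, y)` lies in `W`, outside `W`, or is
undefined. -/
noncomputable def valueColour (f : X × Y → Option Z) (y : Y) (W : Finset Z) (x : X) : Fin 3 :=
  if ∃ z ∈ W, f (x, y) = some z then 0 else if ∃ z ∈ Wᶜ, f (x, y) = some z then 1 else 2

theorem valueColour_eq_zero (f : X × Y → Option Z) (y : Y) (W : Finset Z) (x : X) :
    valueColour f y W x = 0 ↔ ∃ z ∈ W, f (x, y) = some z := by
  unfold valueColour
  split_ifs <;> simp_all

theorem valueColour_eq_one (f : X × Y → Option Z) (y : Y) (W : Finset Z) (x : X) :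
    valueColour f y W x = 1 ↔ ∃ z ∈ Wᶜ, f (x, y) = some z := by
  unfold valueColour
  split_ifs with h1 h2
  · obtain ⟨z, hz, h⟩ := h1
    simp [h, hz]
  · simpa using h2
  · simpa using h2

variable {p}

/-- Cutting a set of inputs according to the value of the function at a fixed `y` makes the
weighted entropy drop by the information that Bob's outcome carries about the part. -/
theorem QProtocol.weightedEntropy_mixture_ge (hp : ∀ x, 0 ≤ p x) (f : X × Y → Option Z) (y : Y)
    (W : Finset Z) (A : Finset X) :
    ∃ e, 0 ≤ e ∧ e ≤ ∑ x ∈ A, p x * P.errProb (partialRel f) x y ∧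
      weightedEntropy (P.mixture p {x ∈ A | valueColour f y W x = 0}) +
        weightedEntropy (P.mixture p {x ∈ A | valueColour f y W x = 1}) +
        weightedEntropy (P.mixture p {x ∈ A | valueColour f y W x = 2}) +
        (∑ x ∈ A with valueColour f y W x = 0, p x + ∑ x ∈ A with valueColour f y W x = 1, p x) *
        (binEntropy ((∑ x ∈ A with valueColour f y W x = 0, p x) /
          (∑ x ∈ A with valueColour f y W x = 0, p x +
            ∑ x ∈ A with valueColour f y W x = 1, p x)) -
        binEntropy (e / (∑ x ∈ A with valueColour f y W x = 0, p x +
            ∑ x ∈ A with valueColour f y W x = 1, p x))) ≤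
      weightedEntropy (P.mixture p A) := by
  set c := valueColour f y W with hc
  have hpsd := P.mixture_posSemidef hp
  have hE : ∀ V : Finset Z, (∑ z ∈ V, P.povm y z).PosSemidef := fun V =>
    posSemidef_sum V fun z _ => P.povm_posSemidef y z
  have hE1 : 1 - ∑ z ∈ W, P.povm y z = ∑ z ∈ Wᶜ, P.povm y z := by
    rw [← P.povm_sum y, ← Finset.sum_add_sum_compl W, add_sub_cancel_left]
  have h1 := weightedEntropy_add_ge_of_measurement (hpsd {x ∈ A | c x = 0})
    (hpsd {x ∈ A | c x = 1}) (hE W) (hE1 ▸ hE Wᶜ)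
  have h2 := weightedEntropy_add_ge ((hpsd {x ∈ A | c x = 0}).add (hpsd {x ∈ A | c x = 1}))
    (hpsd {x ∈ A | c x = 2})
  rw [← P.mixture_fin_three p A c] at h2
  rw [hE1, P.trace_mixture, P.trace_mixture, Complex.ofReal_re, Complex.ofReal_re,
    P.trace_mixture_mul, P.trace_mixture_mul] at h1
  -- The witness is the weight of wrong guesses when Bob announces part 0 exactly if his outcome
  -- lies in `W`; each such guess is an error of the protocol. The undefined part plays no role in
  -- the guess and is split off by concavity.
  refine ⟨∑ x ∈ A with c x = 0, p x * ∑ z ∈ Wᶜ, P.outProb x y z +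
      ∑ x ∈ A with c x = 1, p x * ∑ z ∈ W, P.outProb x y z, ?_, ?_, ?_⟩
  · refine add_nonneg ?_ ?_ <;>
    exact Finset.sum_nonneg fun x _ => mul_nonneg (hp x) <|
      Finset.sum_nonneg fun z _ => P.outProb_nonneg x y z
  · rw [sum_filter_fin_three A c fun x => p x * P.errProb (partialRel f) x y]
    have k0 : ∑ x ∈ A with c x = 0, p x * ∑ z ∈ Wᶜ, P.outProb x y z ≤
        ∑ x ∈ A with c x = 0, p x * P.errProb (partialRel f) x y := by
      refine Finset.sum_le_sum fun x hx => mul_le_mul_of_nonneg_left ?_ (hp x)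
      obtain ⟨z, hz, hf⟩ := (valueColour_eq_zero f y W x).1 (Finset.mem_filter.1 hx).2
      refine P.sum_outProb_le_errProb fun z' hz' => ?_
      simp only [partialRel, Set.mem_ofPred_eq, hf]
      rintro (h | h)
      · cases h
      · cases h
        exact Finset.mem_compl.1 hz' hz
    have k1 : ∑ x ∈ A with c x = 1, p x * ∑ z ∈ W, P.outProb x y z ≤
        ∑ x ∈ A with c x = 1, p x * P.errProb (partialRel f) x y := by
      refine Finset.sum_le_sum fun x hx => mul_le_mul_of_nonneg_left ?_ (hp x)
      obtain ⟨z, hz, hf⟩ := (valueColour_eq_one f y W x).1 (Finset.mem_filter.1 hx).2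
      refine P.sum_outProb_le_errProb fun z' hz' => ?_
      simp only [partialRel, Set.mem_ofPred_eq, hf]
      rintro (h | h)
      · cases h
      · cases h
        exact Finset.mem_compl.1 hz hz'
    have k2 : 0 ≤ ∑ x ∈ A with c x = 2, p x * P.errProb (partialRel f) x y :=
      Finset.sum_nonneg fun x _ => mul_nonneg (hp x) (P.errProb_nonneg _ _ _)
    linarith
  · linarith

end Protocol

/-! ### Consequences of a large rectangle bound -/

section Rectangle

open Classical

variable {X Y Z : Type*} [Fintype X] [Fintype Y]

theorem prob_le_one {Ω : Type*} [Fintype Ω] {μ : Ω → ℝ} (hμ : ∀ ω, 0 ≤ μ ω) (h1 : ∑ ω, μ ω = 1)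
    (E : Set Ω) : prob μ E ≤ 1 :=
  h1 ▸ Finset.sum_le_sum fun ω _ => Set.indicator_le_self' (fun ω _ => hμ ω) ω

theorem rec1_le {ε : ℝ} {μ : X × Y → ℝ} (hμ : ∀ ω, 0 ≤ μ ω) (h1 : ∑ ω, μ ω = 1)
    {f : Set (X × Y × Z)} {R : Set (X × Y)} (hR : IsOneWayRectangle R) (hR0 : 0 < prob μ R)
    (hmono : IsOneWayMonochromatic ε f (condDist μ R)) :
    rec1 ε μ f ≤ logb 2 (1 / prob μ R) := by
  refine csInf_le ⟨0, ?_⟩ ⟨R, hR, hR0, hmono, rfl⟩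
  rintro t ⟨S, -, hS, -, rfl⟩
  exact logb_nonneg one_lt_two (by rw [le_div_iff₀ hS]; simpa using prob_le_one hμ h1 S)

variable {p : X → ℝ} {q : Y → ℝ} {μ : X × Y → ℝ}

theorem sum_product_indicator (hμ : ∀ x y, μ (x, y) = p x * q y) (A : Finset X)
    (S : Set (X × Y)) :
    ∑ ω, (((A : Set X) ×ˢ (Set.univ : Set Y)) ∩ S).indicator μ ω =
      ∑ y, q y * ∑ x ∈ A, if (x, y) ∈ S then p x else 0 := by
  rw [Fintype.sum_prod_type_right]
  refine Finset.sum_congr rfl fun y _ => ?_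
  rw [← Finset.sum_filter_add_sum_filter_not Finset.univ (· ∈ A), Finset.mul_sum]
  have h0 : ∑ x with x ∉ A, (((A : Set X) ×ˢ (Set.univ : Set Y)) ∩ S).indicator μ (x, y) = 0 := by
    refine Finset.sum_eq_zero fun x hx => Set.indicator_of_notMem ?_ _
    simpa using fun h => absurd h (Finset.mem_filter.1 hx).2
  rw [h0, add_zero]
  refine Finset.sum_congr (by ext; simp) fun x hx => ?_
  by_cases h : (x, y) ∈ S
  · rw [Set.indicator_of_mem (by simpa [h] using hx), if_pos h, hμ, mul_comm]
  · rw [Set.indicator_of_notMem (by simp [h]), if_neg h, mul_zero]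

/-- Since `μ` is a product, A × Y has probability p(A). If some `g` had error at most `ε` on it,
this rectangle would compete in the minimum and force the rectangle bound down to -log p(A). -/
theorem error_of_lt_rec1 {ε : ℝ} (hp : p ∈ stdSimplex ℝ X) (hq : q ∈ stdSimplex ℝ Y)
    (hμ : ∀ x y, μ (x, y) = p x * q y) {f : Set (X × Y × Z)} {A : Finset X}
    (hA : 0 < ∑ x ∈ A, p x) (hr : -log (∑ x ∈ A, p x) < rec1 ε μ f * log 2) (g : Y → Z) :
    ε * ∑ x ∈ A, p x < ∑ y, q y * ∑ x ∈ A, if (x, y, g y) ∈ f then 0 else p x := by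
  by_contra! hcon
  have hμ0 : ∀ ω, 0 ≤ μ ω := fun ω => by
    rw [show ω = (ω.1, ω.2) from rfl, hμ]; exact mul_nonneg (hp.1 _) (hq.1 _)
  have hμ1 : ∑ ω, μ ω = 1 := by
    rw [Fintype.sum_prod_type]
    simp only [hμ, ← Finset.mul_sum, hq.2, mul_one, hp.2]
  have hR : prob μ ((A : Set X) ×ˢ (Set.univ : Set Y)) = ∑ x ∈ A, p x := by
    have := sum_product_indicator hμ A Set.univ
    simp only [Set.inter_univ, Set.mem_univ, if_true, ← Finset.sum_mul, hq.2, one_mul] at this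
    exact this
  have hmono : IsOneWayMonochromatic ε f (condDist μ ((A : Set X) ×ˢ (Set.univ : Set Y))) := by
    refine ⟨g, ?_⟩
    have e : prob (condDist μ ((A : Set X) ×ˢ (Set.univ : Set Y)))
        {ω | (ω.1, ω.2, g ω.2) ∈ f} = (∑ y, q y * ∑ x ∈ A,
          if (x, y) ∈ {ω : X × Y | (ω.1, ω.2, g ω.2) ∈ f} then p x else 0) / ∑ x ∈ A, p x := by
      rw [← sum_product_indicator hμ, Finset.sum_div, prob]
      refine Finset.sum_congr rfl fun ω _ => ?_
      rw [Set.inter_comm, ← Set.indicator_indicator]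
      by_cases h : ω ∈ {ω : X × Y | (ω.1, ω.2, g ω.2) ∈ f}
      · rw [Set.indicator_of_mem h, Set.indicator_of_mem h, condDist, hR]
      · rw [Set.indicator_of_notMem h, Set.indicator_of_notMem h, zero_div]
    rw [e, le_div_iff₀ hA]
    have hsum : (∑ y, q y * ∑ x ∈ A,
        if (x, y) ∈ {ω : X × Y | (ω.1, ω.2, g ω.2) ∈ f} then p x else 0) +
        (∑ y, q y * ∑ x ∈ A, if (x, y, g y) ∈ f then 0 else p x) = ∑ x ∈ A, p x := by
      rw [← Finset.sum_add_distrib]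
      calc _ = ∑ y, q y * ∑ x ∈ A, p x := by
            refine Finset.sum_congr rfl fun y _ => ?_
            rw [← mul_add, ← Finset.sum_add_distrib]
            congr 1
            refine Finset.sum_congr rfl fun x _ => ?_
            by_cases h : (x, y, g y) ∈ f <;> simp [h]
        _ = _ := by rw [← Finset.sum_mul, hq.2, one_mul]
    linarith
  have h := rec1_le hμ0 hμ1 ⟨_, rfl⟩ (hR.symm ▸ hA) hmono
  rw [hR, logb, one_div, log_inv, le_div_iff₀ (log_pos one_lt_two)] at h
  linarith

end Rectangle

/-- If no `y` qualifies, then U ≤ (ε/2)N + V/e pointwise: either `U` is small, or V > eN and U ≤ N.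
Averaging over `q` gives at most εN, a contradiction. -/
theorem exists_of_average {Y : Type*} [Fintype Y] {q U V : Y → ℝ} (hq : q ∈ stdSimplex ℝ Y)
    {ε e N : ℝ} (he : 0 < e) (hN : 0 ≤ N) (hε : 0 ≤ ε) (hU : ∀ y, U y ≤ N) (hV : ∀ y, 0 ≤ V y)
    (h1 : ε * N < ∑ y, q y * U y) (h2 : ∑ y, q y * V y ≤ e * (ε / 2) * N) :
    ∃ y, ε / 2 * N ≤ U y ∧ V y ≤ e * N := by
  by_contra! hcon
  have key : ∀ y, U y ≤ ε / 2 * N + V y / e := by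
    intro y
    have hVe := div_nonneg (hV y) he.le
    by_cases h : ε / 2 * N ≤ U y
    · have h3 := (hcon y h).le
      have h4 : N ≤ V y / e := by rw [le_div_iff₀ he]; linarith
      have := mul_nonneg hε hN
      linarith [hU y]
    · linarith
  have h3 : ∑ y, q y * U y ≤ ∑ y, q y * (ε / 2 * N + V y / e) :=
    Finset.sum_le_sum fun y _ => mul_le_mul_of_nonneg_left (key y) (hq.1 y)
  have h4 : ∑ y, q y * (ε / 2 * N + V y / e) = ε / 2 * N + (∑ y, q y * V y) / e := by
    simp only [mul_add, Finset.sum_add_distrib, ← Finset.sum_mul, hq.2, one_mul, Finset.sum_div,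
      mul_div_assoc]
  have h5 : (∑ y, q y * V y) / e ≤ ε / 2 * N := by
    rw [div_le_iff₀ he]; linarith
  linarith

section Main

open Classical

variable {X Y Z : Type*} [Fintype X] [Fintype Y] [Fintype Z]

theorem avgError_eq {m : ℕ} (P : QProtocol X Y Z m) {p : X → ℝ} {q : Y → ℝ} {μ : X × Y → ℝ}
    (hμ : ∀ x y, μ (x, y) = p x * q y) (f : Set (X × Y × Z)) :
    P.avgError μ f = ∑ x, p x * ∑ y, q y * P.errProb f x y := by
  rw [QProtocol.avgError, Fintype.sum_prod_type]
  simp only [hμ, Finset.mul_sum, QProtocol.errProb, mul_assoc]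

/-- For a partial function that is not close to constant on the inputs in `A`, some value colouring
makes the weighted entropy of the message drop by `g` times the weight of `A`. -/
theorem exists_good_split {m : ℕ} (P : QProtocol X Y Z m) [Nonempty Z] {p : X → ℝ} {q : Y → ℝ}
    (hp : p ∈ stdSimplex ℝ X) (hq : q ∈ stdSimplex ℝ Y) {f : X × Y → Option Z}
    {ε e α τ g : ℝ} (hε : 0 ≤ ε) (he : 0 < e) (hτ : 0 < τ) (hτε : τ ≤ ε / 2)
    (hτα : 3 * τ ≤ α) (hα : α ≤ ε / 2 ∨ α ≤ 1 ∧ ∀ ω, f ω ≠ none)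
    (hg : ∀ a b c, τ ≤ a → τ ≤ b → α ≤ a + b → a + b ≤ 1 → 0 ≤ c → c ≤ e →
      g ≤ (a + b) * (binEntropy (a / (a + b)) - binEntropy (c / (a + b))))
    {A : Finset X} (hA : 0 < ∑ x ∈ A, p x)
    (hne : ∀ h : Y → Z, ε * ∑ x ∈ A, p x <
      ∑ y, q y * ∑ x ∈ A, if (x, y, h y) ∈ partialRel f then 0 else p x)
    (herr : ∑ x ∈ A, p x * ∑ y, q y * P.errProb (partialRel f) x y ≤
      e * (ε / 2) * ∑ x ∈ A, p x) :
    ∃ c : X → Fin 3, (∀ i, {x ∈ A | c x = i} ≠ A) ∧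
      weightedEntropy (P.mixture p {x ∈ A | c x = 0}) +
        weightedEntropy (P.mixture p {x ∈ A | c x = 1}) +
        weightedEntropy (P.mixture p {x ∈ A | c x = 2}) + g * ∑ x ∈ A, p x ≤
      weightedEntropy (P.mixture p A) := by
  set N := ∑ x ∈ A, p x with hN
  let w : Y → Z → ℝ := fun y z => ∑ x ∈ A, if f (x, y) = some z then p x else 0
  have hmax : ∀ y, ∃ z, ∀ z', w y z' ≤ w y z := fun y => Finite.exists_max (w y)
  -- The plurality value at each `y`. With it, the error bound also says that no single value
  -- carries almost all of the weight, as the balanced cut requires.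
  choose h hh using hmax
  have hU : ∀ y, ∑ x ∈ A, (if (x, y, h y) ∈ partialRel f then 0 else p x) =
      ∑ z, w y z - w y (h y) := by
    intro y
    simp only [w]
    rw [Finset.sum_comm, ← Finset.sum_sub_distrib]
    refine Finset.sum_congr rfl fun x _ => ?_
    simp only [partialRel, Set.mem_ofPred_eq]
    rcases Option.eq_none_or_eq_some (f (x, y)) with hf | ⟨z, hf⟩
    · simp [hf]
    · by_cases hz : z = h y <;> simp [hf, hz]
  have hwN : ∀ y, ∑ z, w y z ≤ N := by
    intro y
    rw [sum_valueWeight p f y A Finset.univ]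
    exact Finset.sum_le_sum_of_subset_of_nonneg (Finset.filter_subset _ _) fun x _ _ => hp.1 x
  have hw0 : ∀ y z, 0 ≤ w y z := fun y z => Finset.sum_nonneg fun x _ => by
    split_ifs
    exacts [hp.1 x, le_rfl]
  obtain ⟨y, hy1, hy2⟩ := exists_of_average hq (U := fun y => ∑ z, w y z - w y (h y))
    (V := fun y => ∑ x ∈ A, p x * P.errProb (partialRel f) x y) he hA.le hε
    (fun y => by linarith [hwN y, hw0 y (h y)])
    (fun y => Finset.sum_nonneg fun x _ => mul_nonneg (hp.1 x) (P.errProb_nonneg _ _ _))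
    (by simpa only [hU] using hne h)
    (by
      refine le_trans (le_of_eq ?_) herr
      simp only [Finset.mul_sum]
      rw [Finset.sum_comm]
      exact Finset.sum_congr rfl fun x _ => Finset.sum_congr rfl fun y _ => by ring)
  -- For a partial function only the weight off the plurality value is known to be present, hence
  -- ε/2; for a total function every input counts.
  have hατ : α * N ≤ ∑ z, w y z := by
    rcases hα with hα | ⟨hα, hf⟩
    · have := mul_le_mul_of_nonneg_right hα hA.le
      linarith [hw0 y (h y)]
    · have : ∑ z, w y z = N := by
        rw [sum_valueWeight p f y A Finset.univ, Finset.filter_true_of_mem]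
        intro x _
        obtain ⟨z, hz⟩ := Option.ne_none_iff_exists'.1 (hf (x, y))
        exact ⟨z, Finset.mem_univ z, hz⟩
      rw [this]
      have := mul_le_mul_of_nonneg_right hα hA.le
      linarith
  have hτN : τ * N ≤ ε / 2 * N := mul_le_mul_of_nonneg_right hτε hA.le
  have h3τN := mul_le_mul_of_nonneg_right hτα hA.le
  obtain ⟨W, hW1, hW2⟩ := exists_balanced_subset (w y) (τ := τ * N) (by linarith)
    (fun z => by linarith [hh y z]) (by positivity)
  have hn0 : ∑ z ∈ W, w y z = ∑ x ∈ A with valueColour f y W x = 0, p x := by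
    rw [sum_valueWeight p f y A W]
    simp only [valueColour_eq_zero]
  have hn1 : ∑ z, w y z - ∑ z ∈ W, w y z = ∑ x ∈ A with valueColour f y W x = 1, p x := by
    rw [← Finset.sum_add_sum_compl W, add_sub_cancel_left, sum_valueWeight p f y A Wᶜ]
    simp only [valueColour_eq_one]
  rw [hn1] at hW2
  rw [hn0] at hW1
  have hn : ∑ z, w y z = ∑ x ∈ A with valueColour f y W x = 0, p x +
      ∑ x ∈ A with valueColour f y W x = 1, p x := by linarith
  obtain ⟨c, hc0, hc1, hc⟩ := P.weightedEntropy_mixture_ge hp.1 f y W A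
  set n0 := ∑ x ∈ A with valueColour f y W x = 0, p x with hn0'
  set n1 := ∑ x ∈ A with valueColour f y W x = 1, p x with hn1'
  have hτN0 : 0 < τ * N := mul_pos hτ hA
  refine ⟨valueColour f y W, ?_, ?_⟩
  · intro i hi
    have key : ∀ j, j ≠ i → ∑ x ∈ A with valueColour f y W x = j, p x = 0 := by
      intro j hj
      refine Finset.sum_eq_zero fun x hx => ?_
      obtain ⟨hxA, hxj⟩ := Finset.mem_filter.1 hx
      rw [← hi] at hxA
      exact absurd (hxj.symm.trans (Finset.mem_filter.1 hxA).2) hj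
    -- Parts 0 and 1 both have positive weight, so no part is all of `A`.
    by_cases h0 : i = 0
    · have := key 1 (by simp [h0])
      linarith
    · have := key 0 (Ne.symm h0)
      linarith
  · have hgN := hg (n0 / N) (n1 / N) (c / N) (by rwa [le_div_iff₀ hA]) (by rwa [le_div_iff₀ hA])
      (by rw [← add_div, le_div_iff₀ hA]; linarith)
      (by rw [← add_div, div_le_one₀ hA]; linarith [hwN y]) (by positivity)
      (by rw [div_le_iff₀ hA]; linarith)
    rw [← add_div, div_div_div_cancel_right₀ hA.ne', div_div_div_cancel_right₀ hA.ne',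
      div_mul_eq_mul_div, le_div_iff₀ hA] at hgN
    linarith

/-- The number of qubits of a protocol of small error is at least the gain per split times the
rectangle bound. -/
theorem QProtocol.rec1_le_qubits {m : ℕ} (P : QProtocol X Y Z m) [Nonempty Z] {p : X → ℝ}
    {q : Y → ℝ} (hp : p ∈ stdSimplex ℝ X) (hq : q ∈ stdSimplex ℝ Y) {μ : X × Y → ℝ}
    (hμ : ∀ x y, μ (x, y) = p x * q y) {f : X × Y → Option Z}
    {ε e α τ g : ℝ} (hε : 0 < ε) (he : 0 < e) (hτ : 0 < τ) (hτε : τ ≤ ε / 2)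
    (hτα : 3 * τ ≤ α) (hα : α ≤ ε / 2 ∨ α ≤ 1 ∧ ∀ ω, f ω ≠ none) (hg0 : 0 ≤ g)
    (hg : ∀ a b c, τ ≤ a → τ ≤ b → α ≤ a + b → a + b ≤ 1 → 0 ≤ c → c ≤ e →
      g ≤ (a + b) * (binEntropy (a / (a + b)) - binEntropy (c / (a + b))))
    (hr : 0 ≤ rec1 ε μ (partialRel f))
    (herr : P.avgError μ (partialRel f) ≤ e * (ε / 2) * ε) :
    g * (rec1 ε μ (partialRel f) * (1 - ε)) ≤ 2 * log 2 * m := by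
  have hd : 0 < e * (ε / 2) := by positivity
  have hl := log_pos one_lt_two
  have key := potential_ge_of_recursive_split (p := p)
    (cost := fun x => p x * ∑ y, q y * P.errProb (partialRel f) x y)
    (Φ := fun A => weightedEntropy (P.mixture p A)) (g := g)
    (r := rec1 ε μ (partialRel f) * log 2) (d := e * (ε / 2)) hg0 (mul_nonneg hr hl.le) hd hp.1
    (fun x => mul_nonneg (hp.1 x) <| Finset.sum_nonneg fun y _ =>
      mul_nonneg (hq.1 y) (P.errProb_nonneg _ _ _))
    (fun A => weightedEntropy_nonneg (P.mixture_posSemidef hp.1 A))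
    (fun A hA0 hA1 hA2 => exists_good_split P hp hq hε.le he hτ hτε hτα hα hg hA0
      (fun h => error_of_lt_rec1 hp hq hμ hA0 hA1 h) hA2.le)
    Finset.univ hp.2.le
  rw [hp.2, negMulLog_one, sub_zero, ← avgError_eq P hμ] at key
  -- The last factor `ε` of the error budget: leaves of large cost have total weight at most `ε`.
  have h1 : P.avgError μ (partialRel f) / (e * (ε / 2)) ≤ ε := by
    rw [div_le_iff₀ hd]; linarith
  have h2 : weightedEntropy (P.mixture p Finset.univ) ≤ m * log 2 := by
    refine (weightedEntropy_le (P.mixture_posSemidef hp.1 _) ?_).trans (le_of_eq ?_)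
    · rw [P.trace_mixture, hp.2, Complex.ofReal_one]
    · simp
  have h3 := mul_le_mul_of_nonneg_left (sub_le_sub_left h1 1)
    (mul_nonneg hg0 (mul_nonneg hr hl.le))
  have h4 := mul_le_mul_of_nonneg_left h2 (by positivity : 0 ≤ 2 * log 2)
  refine le_of_mul_le_mul_right ?_ hl
  linarith

end Main

/-! ### Existence of protocols -/

open Classical in
/-- The protocol in which Alice sends the code `c x` of her input as a basis state and Bob
answers `a x y` when he reads the code of `x`. -/
noncomputable def QProtocol.ofCode {X Y Z : Type*} [Fintype Z] {m : ℕ}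
    (c : X → Fin m → Fin 2) (a : (Fin m → Fin 2) → Y → Z) : QProtocol X Y Z m where
  state x := diagonal (Pi.single (c x) 1)
  state_posSemidef x := PosSemidef.diagonal (Pi.single_nonneg.2 zero_le_one)
  state_trace x := by simp [trace_diagonal]
  povm y z := diagonal fun b => if a b y = z then 1 else 0
  povm_posSemidef y z := PosSemidef.diagonal fun b => by
    by_cases h : a b y = z <;> simp [h]
  povm_sum y := by
    ext i j
    rw [Matrix.sum_apply]
    by_cases h : i = j
    · subst h
      simp
    · simp [h]

open Classical in
theorem QProtocol.outProb_ofCode {X Y Z : Type*} [Fintype Z] {m : ℕ}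
    (c : X → Fin m → Fin 2) (a : (Fin m → Fin 2) → Y → Z) (x : X) (y : Y) (z : Z) :
    (QProtocol.ofCode c a).outProb x y z = if a (c x) y = z then 1 else 0 := by
  simp only [QProtocol.outProb, QProtocol.ofCode, diagonal_mul_diagonal, trace_diagonal]
  rw [Finset.sum_eq_single (c x)]
  · by_cases h : a (c x) y = z <;> simp [h]
  · intro b _ hb
    simp [Pi.single_eq_of_ne hb]
  · simp

/-- Alice can send her whole input in card X bits. This makes the infimum defining `Q1` an attained
minimum and not the default value 0. -/
theorem exists_protocol_avgError_zero {X Y Z : Type*} [Fintype X] [Fintype Y] [Fintype Z]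
    [Nonempty X] (μ : X × Y → ℝ) {f : Set (X × Y × Z)} (hf : ∀ x y, ∃ z, (x, y, z) ∈ f) :
    ∃ (m : ℕ) (P : QProtocol X Y Z m), P.avgError μ f = 0 := by
  classical
  choose a ha using hf
  have hcard : Fintype.card X ≤ Fintype.card (Fin (Fintype.card X) → Fin 2) := by
    simpa using Nat.lt_two_pow_self.le
  obtain ⟨c⟩ := Function.Embedding.nonempty_of_card_le hcard
  refine ⟨Fintype.card X, QProtocol.ofCode c fun b => a (Function.invFun c b), ?_⟩
  refine Finset.sum_eq_zero fun ω _ => mul_eq_zero_of_right _ (Finset.sum_eq_zero fun z _ => ?_)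
  refine Set.indicator_apply_eq_zero.2 fun hz => ?_
  rw [QProtocol.outProb_ofCode, Function.leftInverse_invFun c.injective, if_neg]
  rintro rfl
  exact hz (ha _ _)

/-! ### The gain of a split -/

theorem gain_total {ε : ℝ} (hε0 : 0 < ε) (hε1 : ε < 1 / 2) (a b c : ℝ) (ha : ε / 2 ≤ a)
    (hb : ε / 2 ≤ b) (hab : 1 ≤ a + b) (hab1 : a + b ≤ 1) (hc0 : 0 ≤ c) (hc : c ≤ ε / 4) :
    binEntropy (ε / 2) - binEntropy (ε / 4) ≤
      (a + b) * (binEntropy (a / (a + b)) - binEntropy (c / (a + b))) := by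
  rw [le_antisymm hab1 hab, one_mul, div_one, div_one]
  have h1 := binEntropy_le_of_mem_Icc (x := a) (by linarith) ha (by linarith)
  have h2 := binEntropy_le_of_mem_Icc (x := ε / 4) hc0 hc (by linarith)
  linarith

theorem gain_partial {ε : ℝ} (hε0 : 0 < ε) (hε1 : ε < 1 / 2) (a b c : ℝ) (ha : ε / 6 ≤ a)
    (hb : ε / 6 ≤ b) (hab : ε / 2 ≤ a + b) (hab1 : a + b ≤ 1) (hc0 : 0 ≤ c)
    (hc : c ≤ (ε / 15) ^ 4) :
    ε ^ 2 / 300 * log 2 ≤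
      (a + b) * (binEntropy (a / (a + b)) - binEntropy (c / (a + b))) := by
  have hs : 0 < a + b := by linarith
  have hl := log_two_gt_d9
  have hε4 : (ε / 15) ^ 4 ≤ ε / 6 := by
    have : (ε / 15) ^ 4 ≤ (ε / 15) ^ 1 :=
      pow_le_pow_of_le_one (by positivity) (by linarith) (by norm_num)
    linarith
  have h1 : 2 * (ε / 6 / (a + b)) * log 2 ≤ binEntropy (a / (a + b)) := by
    have h0 : ε / 6 / (a + b) ≤ 1 / 2 := by
      rw [div_le_iff₀ hs]; linarith
    refine (two_mul_log_two_le_binEntropy (by positivity) h0).trans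
      (binEntropy_le_of_mem_Icc (by positivity) (by gcongr) ?_)
    rw [le_sub_iff_add_le, ← add_div, div_le_one₀ hs]
    linarith
  -- The fourth power is the square of (ε/15)², so the error entropy is only quadratic in `ε`,
  -- against the linear main term (ε/3) log 2.
  have h2 : (a + b) * binEntropy (c / (a + b)) ≤ 2 * (ε / 15) ^ 2 := by
    refine (mul_binEntropy_div_le hs hab1 hc0 (by linarith)).trans ?_
    refine le_trans ?_ (binEntropy_sq_le (by positivity) (by nlinarith))
    exact binEntropy_le_of_mem_Icc hc0 (by rw [← pow_mul]; exact hc) (by nlinarith)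
  have h3 := mul_le_mul_of_nonneg_left h1 hs.le
  have h4 : (a + b) * (2 * (ε / 6 / (a + b)) * log 2) = ε / 3 * log 2 := by
    field_simp
    norm_num
  rw [h4] at h3
  have h5 : ε * ε ≤ ε * (1 / 2) := mul_le_mul_of_nonneg_left hε1.le hε0.le
  have h6 : ε * 0.69 ≤ ε * log 2 := mul_le_mul_of_nonneg_left (by linarith) hε0.le
  have h7 : ε ^ 2 * log 2 ≤ ε ^ 2 * 1 :=
    mul_le_mul_of_nonneg_left (by linarith [log_two_lt_d9]) (by positivity)
  nlinarith

/-! ### The lower bound on quantum communication -/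

theorem qubits_ge_of_gain {X Y Z : Type*} [Fintype X] [Fintype Y] [Fintype Z]
    {f : X × Y → Option Z} {μ : X × Y → ℝ} (hμ : IsProductDistribution μ) {ε e α τ g : ℝ}
    (hε : 0 < ε) (hε1 : ε < 1 / 2) (he : 0 < e) (hτ : 0 < τ) (hτε : τ ≤ ε / 2) (hτα : 3 * τ ≤ α)
    (hα : α ≤ ε / 2 ∨ α ≤ 1 ∧ ∀ ω, f ω ≠ none) (hg0 : 0 ≤ g)
    (hg : ∀ a b c, τ ≤ a → τ ≤ b → α ≤ a + b → a + b ≤ 1 → 0 ≤ c → c ≤ e →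
      g * log 2 ≤ (a + b) * (binEntropy (a / (a + b)) - binEntropy (c / (a + b))))
    (hr : 2 * logb 2 (1 / ε) < rec1 ε μ (partialRel f)) :
    1 / 2 * (1 - 2 * ε) * g * ((⌊rec1 ε μ (partialRel f)⌋ : ℝ) - 1) ≤
        (Q1 (e * (ε / 2) * ε) μ (partialRel f) : ℝ) ∧
      1 / 2 * (1 - 2 * ε) * g / 3 * rec1 ε μ (partialRel f) ≤
        1 / 2 * (1 - 2 * ε) * g * ((⌊rec1 ε μ (partialRel f)⌋ : ℝ) - 1) := by
  obtain ⟨p, hp, q, hq, hpq⟩ := hμ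
  have hl := log_pos one_lt_two
  -- The threshold is needed only through log(1/ε) ≥ 1: a bound above 2 suffices.
  have h2r : 2 < rec1 ε μ (partialRel f) := by
    have : logb 2 2 ≤ logb 2 (1 / ε) :=
      logb_le_logb_of_le one_lt_two two_pos (by rw [le_div_iff₀ hε]; linarith)
    rw [logb_self_eq_one one_lt_two] at this
    linarith
  have hX : Nonempty X := by
    by_contra h
    rw [not_nonempty_iff] at h
    simpa using hp.2
  have hY : Nonempty Y := by
    by_contra h
    rw [not_nonempty_iff] at h
    simpa using hq.2
  have hZ : Nonempty Z := by
    by_contra h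
    rw [not_nonempty_iff] at h
    -- Without answers there is no map Y → Z, so the infimum is over the empty set and takes the
    -- default value 0.
    have : rec1 ε μ (partialRel f) = 0 := by
      rw [rec1]
      convert Real.sInf_empty
      ext t
      simp only [Set.mem_ofPred_eq, Set.mem_empty_iff_false, iff_false]
      rintro ⟨R, -, -, ⟨k, -⟩, -⟩
      exact h.elim (k hY.some)
    linarith
  have hex : ∀ x y, ∃ z, (x, y, z) ∈ partialRel f := by
    intro x y
    rcases Option.eq_none_or_eq_some (f (x, y)) with hf | ⟨z, hf⟩
    · exact ⟨hZ.some, Or.inl hf⟩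
    · exact ⟨z, Or.inr hf⟩
  set r := rec1 ε μ (partialRel f) with hr'
  have hfl := Int.floor_le r
  have hfl2 : (2 : ℝ) ≤ (⌊r⌋ : ℝ) := by
    exact_mod_cast Int.le_floor.2 (by exact_mod_cast h2r.le)
  have hfl3 := Int.lt_floor_add_one r
  have hc : 0 ≤ 1 / 2 * (1 - 2 * ε) * g := mul_nonneg (by linarith) hg0
  constructor
  · obtain ⟨m, P, hP⟩ := exists_protocol_avgError_zero μ hex
    obtain ⟨P', hP'⟩ := Nat.sInf_mem (s := {m | ∃ P : QProtocol X Y Z m,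
      P.avgError μ (partialRel f) ≤ e * (ε / 2) * ε}) ⟨m, P, by rw [hP]; positivity⟩
    have key := P'.rec1_le_qubits hp hq hpq hε he hτ hτε hτα hα (mul_nonneg hg0 hl.le) hg
      (by linarith) hP'
    rw [← hr'] at key
    have h1 : g * (r * (1 - ε)) ≤ 2 * (Q1 (e * (ε / 2) * ε) μ (partialRel f) : ℝ) := by
      refine le_of_mul_le_mul_right ?_ hl
      have : ((sInf {m | ∃ P : QProtocol X Y Z m,
        P.avgError μ (partialRel f) ≤ e * (ε / 2) * ε} : ℕ) : ℝ) =
          (Q1 (e * (ε / 2) * ε) μ (partialRel f) : ℝ) := rfl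
      rw [this] at key
      linarith
    have h2 : (1 - 2 * ε) * ((⌊r⌋ : ℝ) - 1) ≤ r * (1 - ε) := by
      calc (1 - 2 * ε) * ((⌊r⌋ : ℝ) - 1) ≤ (1 - ε) * r :=
            mul_le_mul (by linarith) (by linarith) (by linarith) (by linarith)
        _ = _ := mul_comm _ _
    have h3 := mul_le_mul_of_nonneg_left h2 hg0
    linarith
  -- From r < ⌊r⌋ + 1 and ⌊r⌋ ≥ 2 one gets r ≤ 3(⌊r⌋ - 1); this is the 3 in the final constants.
  · have : r / 3 ≤ (⌊r⌋ : ℝ) - 1 := by linarith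
    have := mul_le_mul_of_nonneg_left this hc
    linarith

theorem totalRel_eq_partialRel {X Y Z : Type*} (f : X × Y → Z) :
    totalRel f = partialRel (fun ω => some (f ω)) := by
  ext t
  simp [totalRel, partialRel]

end OneWayComm

theorem mainTheorem3 (ε : ℝ) (hε0 : 0 < ε) (hε1 : ε < 1 / 2) :
    (∃ c : ℝ, 0 < c ∧
      ∀ (X Y Z : Type*) [Fintype X] [Fintype Y] [Fintype Z] (f : X × Y → Z) (μ : X × Y → ℝ),
        OneWayComm.IsProductDistribution μ →
        2 * Real.logb 2 (1 / ε) < OneWayComm.rec1 ε μ (OneWayComm.totalRel f) →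
          1 / 2 * (1 - 2 * ε) *
              (OneWayComm.binaryEntropy (ε / 2) - OneWayComm.binaryEntropy (ε / 4)) *
              ((⌊OneWayComm.rec1 ε μ (OneWayComm.totalRel f)⌋ : ℝ) - 1)
            ≤ (OneWayComm.Q1 (ε ^ 3 / 8) μ (OneWayComm.totalRel f) : ℝ) ∧
          c * OneWayComm.rec1 ε μ (OneWayComm.totalRel f)
            ≤ 1 / 2 * (1 - 2 * ε) *
              (OneWayComm.binaryEntropy (ε / 2) - OneWayComm.binaryEntropy (ε / 4)) *
              ((⌊OneWayComm.rec1 ε μ (OneWayComm.totalRel f)⌋ : ℝ) - 1)) ∧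
    (∃ c : ℝ, 0 < c ∧
      ∀ (X Y Z : Type*) [Fintype X] [Fintype Y] [Fintype Z] (f : X × Y → Option Z)
        (μ : X × Y → ℝ),
        OneWayComm.IsProductDistribution μ →
        2 * Real.logb 2 (1 / ε) < OneWayComm.rec1 ε μ (OneWayComm.partialRel f) →
          1 / 2 * (1 - 2 * ε) * (ε ^ 2 / 300) *
              ((⌊OneWayComm.rec1 ε μ (OneWayComm.partialRel f)⌋ : ℝ) - 1)
            ≤ (OneWayComm.Q1 (ε ^ 6 / (2 * 15 ^ 4)) μ (OneWayComm.partialRel f) : ℝ) ∧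
          c * OneWayComm.rec1 ε μ (OneWayComm.partialRel f)
            ≤ 1 / 2 * (1 - 2 * ε) * (ε ^ 2 / 300) *
              ((⌊OneWayComm.rec1 ε μ (OneWayComm.partialRel f)⌋ : ℝ) - 1)) := by
  have hl := Real.log_pos one_lt_two
  refine ⟨⟨1 / 2 * (1 - 2 * ε) * (OneWayComm.binaryEntropy (ε / 2) -
    OneWayComm.binaryEntropy (ε / 4)) / 3, ?_, ?_⟩,
    ⟨1 / 2 * (1 - 2 * ε) * (ε ^ 2 / 300) / 3, ?_, ?_⟩⟩
  · have h1 : Real.binEntropy (ε / 4) < Real.binEntropy (ε / 2) :=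
      Real.binEntropy_strictMonoOn ⟨by linarith, by linarith [inv_eq_one_div (2 : ℝ)]⟩
        ⟨by linarith, by linarith [inv_eq_one_div (2 : ℝ)]⟩ (by linarith)
    rw [OneWayComm.binaryEntropy_eq, OneWayComm.binaryEntropy_eq, ← sub_div]
    have h2 : 0 < 1 - 2 * ε := by linarith
    have h3 := div_pos (sub_pos.2 h1) hl
    positivity
  · intro X Y Z _ _ _ f μ hμ hr
    rw [OneWayComm.totalRel_eq_partialRel] at hr ⊢
    have hmono : Real.binEntropy (ε / 4) ≤ Real.binEntropy (ε / 2) :=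
      OneWayComm.binEntropy_le_of_mem_Icc (by linarith) (by linarith) (by linarith)
    -- The whole of `A` is split in two (α = 1), each side with an ε/2 share; 3τ ≤ α holds because ε
    -- < 1/2.
    have h := OneWayComm.qubits_ge_of_gain hμ (e := ε / 4) (α := 1) (τ := ε / 2)
      (g := OneWayComm.binaryEntropy (ε / 2) - OneWayComm.binaryEntropy (ε / 4)) hε0 hε1
      (by linarith) (by linarith) le_rfl (by linarith) (Or.inr ⟨le_rfl, fun _ => by simp⟩)
      (by
        rw [OneWayComm.binaryEntropy_eq, OneWayComm.binaryEntropy_eq, ← sub_div]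
        exact div_nonneg (sub_nonneg.2 hmono) hl.le)
      (by
        rw [OneWayComm.binaryEntropy_eq, OneWayComm.binaryEntropy_eq, ← sub_div,
          div_mul_cancel₀ _ hl.ne']
        exact OneWayComm.gain_total hε0 hε1)
      hr
    rwa [show ε / 4 * (ε / 2) * ε = ε ^ 3 / 8 by ring] at h
  · have h2 : 0 < 1 - 2 * ε := by linarith
    positivity
  · intro X Y Z _ _ _ f μ hμ hr
    -- Only an ε/2 share of `A` is sure to have defined values, so the balanced cut guarantees a
    -- third of it, ε/6, on each side.
    have h := OneWayComm.qubits_ge_of_gain hμ (e := (ε / 15) ^ 4) (α := ε / 2) (τ := ε / 6)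
      (g := ε ^ 2 / 300) hε0 hε1 (by positivity) (by linarith) (by linarith) (by linarith)
      (Or.inl le_rfl) (by positivity) (OneWayComm.gain_partial hε0 hε1) hr
    rwa [show (ε / 15) ^ 4 * (ε / 2) * ε = ε ^ 6 / (2 * 15 ^ 4) by ring] at h
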